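/- Let $n\in\mathbb N$ and let $N$ be an $(n+1)$-dimensional semi-Riemannian space with metric $\bar g$ ($N$ of class $C^3$, $\bar g$ symmetric, nondegenerate and of class $C^2$; for instance a smooth Riemannian or Lorentzian manifold). A hypersurface in $N$ is given by a $C^3$ immersion $x\colon M\to N$ of an $n$-dimensional $C^3$ manifold; it is assumed to be spacelike (the induced metric $g_{ij}$ is positive definite) and equipped with a continuous normal field $\nu$ with $\sigma=\langle\nu,\nu\rangle=\pm1$. Its second fundamental form $h_{ij}$ is defined by the Gauss formula $x^\alpha_{ij}=-\sigma h_{ij}\nu^\alpha$, and its principal curvatures $\kappa_1,\dots,\kappa_n$ are the eigenvalues of $h^i_j=g^{ik}h_{kj}$. For $1\le k\le n$ let $H_k(\kappa)=\sum_{i_1<\dots<i_k}\kappa_{i_1}\cdots\kappa_{i_k}$ be the $k$-th elementary symmetric polynomial. Let $\Gamma_1=\mathbb R^n$, and for $k\ge2$ let $\Gamma_k\subset\mathbb R^n$ be the connected component of $\{H_k>0\}$ that contains $(1,\dots,1)$. A hypersurface is admissible for $H_k$ if at each of its points $(\kappa_1,\dots,\kappa_n)\in\Gamma_k$. View $F=H_k$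 as a function of $(h_{ij})$ and $(g_{ij})$ and let $F^{ij}=\partial F/\partial h_{ij}$ be the symmetric tensor with $dF(\eta)=F^{ij}\eta_{ij}$ for all symmetric $\eta$. We say that $H_k$ is of class $(D)$ in $N$ if, for every hypersurface $M$ that is admissible for $H_k$, the tensor $F^{ij}$, evaluated at $M$, exists, is differentiable and is divergence free: $F^{ij}{}_{;j}=0$ on $M$, where the semicolon denotes covariant differentiation with respect to the induced metric. Then: (i) If $N$ has constant curvature (the sectional curvatures of all nondegenerate tangent planes equal one constant), then $H_k$ is of class $(D)$ in $N$ for every $1\le k\le n$. (ii) If $n\ge2$ and $N$ is Einstein, i.e. $\bar R_{\alpha\beta}=\lambda\,\bar g_{\alpha\beta}$ for some function $\lambda$ on $N$, then $H_2$ is of class $(D)$ in $N$. -/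

import Mathlib

open scoped Manifold ContDiff

universe u v

noncomputable section

namespace CurvatureFlow

/-! ### Tensor calculus in a coordinate system -/

/-- The partial derivative `∂f/∂yⁱ`. -/
def pd {m : ℕ} (i : Fin m) (f : EuclideanSpace ℝ (Fin m) → ℝ) (y : EuclideanSpace ℝ (Fin m)) : ℝ :=
  fderiv ℝ f y (EuclideanSpace.single i 1)

/-- The Christoffel symbols `Γᵏᵢⱼ = ½ gᵏˡ (∂ᵢ gⱼₗ + ∂ⱼ gᵢₗ - ∂ₗ gᵢⱼ)` of the metric with
components `G` (upper index first). -/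
def christoffel {m : ℕ} (G : EuclideanSpace ℝ (Fin m) → Matrix (Fin m) (Fin m) ℝ)
    (k i j : Fin m) (y : EuclideanSpace ℝ (Fin m)) : ℝ :=
  (1 / 2) * ∑ l, (G y)⁻¹ k l *
    (pd i (fun z => G z j l) y + pd j (fun z => G z i l) y - pd l (fun z => G z i j) y)

/-- The curvature tensor `Rᵃ_{bcd} = ∂_c Γᵃ_{bd} - ∂_d Γᵃ_{bc} + Γᵃ_{ce} Γᵉ_{bd} - Γᵃ_{de} Γᵉ_{bc}`,
so that `R(∂_c, ∂_d) ∂_b = Rᵃ_{bcd} ∂_a`. -/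
def riemannUp {m : ℕ} (G : EuclideanSpace ℝ (Fin m) → Matrix (Fin m) (Fin m) ℝ)
    (a b c d : Fin m) (y : EuclideanSpace ℝ (Fin m)) : ℝ :=
  pd c (christoffel G a b d) y - pd d (christoffel G a b c) y
    + ∑ e, (christoffel G a c e y * christoffel G e b d y
        - christoffel G a d e y * christoffel G e b c y)

/-- The covariant curvature tensor `R_{abcd} = g_{ae} Rᵉ_{bcd}`. -/
def riemann {m : ℕ} (G : EuclideanSpace ℝ (Fin m) → Matrix (Fin m) (Fin m) ℝ)
    (a b c d : Fin m) (y : EuclideanSpace ℝ (Fin m)) : ℝ :=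
  ∑ e, G y a e * riemannUp G e b c d y

/-- The Ricci tensor `R_{bd} = Rᵃ_{bad}`. -/
def ricci {m : ℕ} (G : EuclideanSpace ℝ (Fin m) → Matrix (Fin m) (Fin m) ℝ)
    (b d : Fin m) (y : EuclideanSpace ℝ (Fin m)) : ℝ :=
  ∑ a, riemannUp G a b a d y

/-- `⟨v, v⟩⟨w, w⟩ - ⟨v, w⟩²`; the plane spanned by `v` and `w` is nondegenerate if and only if
this does not vanish. -/
def planeForm {m : ℕ} (A : Matrix (Fin m) (Fin m) ℝ) (v w : Fin m → ℝ) : ℝ :=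
  (v ⬝ᵥ A.mulVec v) * (w ⬝ᵥ A.mulVec w) - (v ⬝ᵥ A.mulVec w) ^ 2

/-- The sectional curvature of the plane spanned by `v` and `w` at `y`. -/
def sectionalCurvature {m : ℕ} (G : EuclideanSpace ℝ (Fin m) → Matrix (Fin m) (Fin m) ℝ)
    (y : EuclideanSpace ℝ (Fin m)) (v w : Fin m → ℝ) : ℝ :=
  (∑ a, ∑ b, ∑ c, ∑ d, riemann G a b c d y * v a * w b * v c * w d) / planeForm (G y) v w

/-- The contravariant tensor `Tⁱʲ` is differentiable and has vanishing divergence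
`Tⁱʲ_{;j} = ∂ⱼ Tⁱʲ + Γⁱⱼₖ Tᵏʲ + Γʲⱼₖ Tⁱᵏ` at `y`, covariant differentiation being with respect
to the metric with components `G`. -/
def DivergenceFreeAt {m : ℕ} (G T : EuclideanSpace ℝ (Fin m) → Matrix (Fin m) (Fin m) ℝ)
    (y : EuclideanSpace ℝ (Fin m)) : Prop :=
  (∀ i j, DifferentiableAt ℝ (fun z => T z i j) y) ∧
  ∀ i, ∑ j, (pd j (fun z => T z i j) y
      + ∑ k, christoffel G i j k y * T y k j
      + ∑ k, christoffel G j j k y * T y i k) = 0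

/-! ### The ambient space -/

/-- The charts of class `C³`, i.e. the local coordinate systems, of an `m`-dimensional manifold. -/
abbrev charts (m : ℕ) (N : Type*) [TopologicalSpace N] [ChartedSpace (EuclideanSpace ℝ (Fin m)) N] :
    Set (OpenPartialHomeomorph N (EuclideanSpace ℝ (Fin m))) :=
  IsManifold.maximalAtlas (𝓡 m) 3 N

/-- The coordinate vector field `∂/∂yⁱ` of the chart `φ`, at the point with coordinates `y`. -/
def coordVector {m : ℕ} {N : Type*} [TopologicalSpace N]
    [ChartedSpace (EuclideanSpace ℝ (Fin m)) N]
    (φ : OpenPartialHomeomorph N (EuclideanSpace ℝ (Fin m))) (y : EuclideanSpace ℝ (Fin m))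
    (i : Fin m) : TangentSpace (𝓡 m) (φ.symm y) :=
  mfderiv (𝓡 m) (𝓡 m) φ.symm y (EuclideanSpace.single i (1 : ℝ) : EuclideanSpace ℝ (Fin m))

/-- The components of a field of bilinear forms in the chart `φ`, as functions of the
coordinates. -/
def components {m : ℕ} {N : Type*} [TopologicalSpace N]
    [ChartedSpace (EuclideanSpace ℝ (Fin m)) N]
    (b : ∀ p : N, LinearMap.BilinForm ℝ (TangentSpace (𝓡 m) p))
    (φ : OpenPartialHomeomorph N (EuclideanSpace ℝ (Fin m))) (y : EuclideanSpace ℝ (Fin m)) :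
    Matrix (Fin m) (Fin m) ℝ :=
  Matrix.of fun i j => b (φ.symm y) (coordVector φ y i) (coordVector φ y j)

/-- A semi-Riemannian metric of class `C²`: a field of nondegenerate symmetric bilinear forms on
the tangent spaces whose components in every coordinate system are of class `C²`. -/
structure SemiRiemannianMetric (m : ℕ) (N : Type*) [TopologicalSpace N]
    [ChartedSpace (EuclideanSpace ℝ (Fin m)) N] where
  form : ∀ p : N, LinearMap.BilinForm ℝ (TangentSpace (𝓡 m) p)
  symm : ∀ p v w, form p v w = form p w v
  nondegenerate : ∀ p v, (∀ w, form p v w = 0) → v = 0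
  contDiffOn : ∀ φ ∈ charts m N, ∀ i j,
    ContDiffOn ℝ 2 (fun y => components form φ y i j) φ.target

/-- The sectional curvature of all nondegenerate tangent planes is one and the same number. -/
def SemiRiemannianMetric.HasConstantCurvature {m : ℕ} {N : Type*} [TopologicalSpace N]
    [ChartedSpace (EuclideanSpace ℝ (Fin m)) N] (g : SemiRiemannianMetric m N) : Prop :=
  ∃ K : ℝ, ∀ φ ∈ charts m N, ∀ y ∈ φ.target, ∀ v w : Fin m → ℝ,
    planeForm (components g.form φ y) v w ≠ 0 →
      sectionalCurvature (components g.form φ) y v w = K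

/-- The Ricci tensor is a multiple of the metric. The factor may be a function; in dimension at
least three this is no more general on a smooth connected space. -/
def SemiRiemannianMetric.IsEinstein {m : ℕ} {N : Type*} [TopologicalSpace N]
    [ChartedSpace (EuclideanSpace ℝ (Fin m)) N] (g : SemiRiemannianMetric m N) : Prop :=
  ∃ c : N → ℝ, ∀ φ ∈ charts m N, ∀ y ∈ φ.target, ∀ a b,
    ricci (components g.form φ) a b y = c (φ.symm y) * components g.form φ y a b

/-! ### Hypersurfaces -/

/-- A spacelike, orientable (immersed) hypersurface of class `C³` with a chosen continuous unit
normal `ν`. That `x` is an immersion is contained in `spacelike`. -/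
structure SpacelikeHypersurface {n : ℕ} {N : Type*} [TopologicalSpace N]
    [ChartedSpace (EuclideanSpace ℝ (Fin (n + 1))) N] [IsManifold (𝓡 (n + 1)) 3 N]
    (g : SemiRiemannianMetric (n + 1) N)
    (M : Type*) [TopologicalSpace M] [ChartedSpace (EuclideanSpace ℝ (Fin n)) M] where
  x : M → N
  contMDiff : ContMDiff (𝓡 n) (𝓡 (n + 1)) 3 x
  spacelike : ∀ (p : M) (v : TangentSpace (𝓡 n) p), v ≠ 0 →
    0 < g.form (x p) (mfderiv (𝓡 n) (𝓡 (n + 1)) x p v) (mfderiv (𝓡 n) (𝓡 (n + 1)) x p v)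
  ν : ∀ p : M, TangentSpace (𝓡 (n + 1)) (x p)
  ν_continuous : Continuous fun p => (⟨x p, ν p⟩ : TangentBundle (𝓡 (n + 1)) N)
  ν_orthogonal : ∀ (p : M) (v : TangentSpace (𝓡 n) p),
    g.form (x p) (ν p) (mfderiv (𝓡 n) (𝓡 (n + 1)) x p v) = 0
  ν_unit : ∀ p : M, |g.form (x p) (ν p) (ν p)| = 1

namespace SpacelikeHypersurface

variable {n : ℕ} {N : Type*} [TopologicalSpace N]
  [ChartedSpace (EuclideanSpace ℝ (Fin (n + 1))) N] [IsManifold (𝓡 (n + 1)) 3 N]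
  {g : SemiRiemannianMetric (n + 1) N}
  {M : Type*} [TopologicalSpace M] [ChartedSpace (EuclideanSpace ℝ (Fin n)) M]
  (S : SpacelikeHypersurface g M)
  (φ : OpenPartialHomeomorph N (EuclideanSpace ℝ (Fin (n + 1))))
  (ψ : OpenPartialHomeomorph M (EuclideanSpace ℝ (Fin n)))

/-- The set of coordinates `ξ` in the chart `ψ` of `M` of the points that `x` maps into the
domain of the chart `φ` of `N`. -/
def domain : Set (EuclideanSpace ℝ (Fin n)) :=
  {ξ | ξ ∈ ψ.target ∧ S.x (ψ.symm ξ) ∈ φ.source}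

/-- The coordinate expression `x^α(ξ)` of the hypersurface. -/
def coord (ξ : EuclideanSpace ℝ (Fin n)) : EuclideanSpace ℝ (Fin (n + 1)) :=
  φ (S.x (ψ.symm ξ))

/-- `x^α_i = ∂x^α/∂ξⁱ`. -/
def coordDeriv (a : Fin (n + 1)) (i : Fin n) (ξ : EuclideanSpace ℝ (Fin n)) : ℝ :=
  pd i (fun ζ => S.coord φ ψ ζ a) ξ

/-- The components `ν^α(ξ)` of the normal. -/
def normal (ξ : EuclideanSpace ℝ (Fin n)) : EuclideanSpace ℝ (Fin (n + 1)) :=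
  mfderiv (𝓡 (n + 1)) (𝓡 (n + 1)) φ (S.x (ψ.symm ξ)) (S.ν (ψ.symm ξ))

/-- The induced metric `g_{ij} = ḡ_{αβ} x^α_i x^β_j`. -/
def inducedMetric (ξ : EuclideanSpace ℝ (Fin n)) : Matrix (Fin n) (Fin n) ℝ :=
  Matrix.of fun i j => ∑ a, ∑ b, components g.form φ (S.coord φ ψ ξ) a b
    * S.coordDeriv φ ψ a i ξ * S.coordDeriv φ ψ b j ξ

/-- The covariant derivative
`x^α_{ij} = ∂ᵢ∂ⱼ x^α - Γᵏᵢⱼ x^α_k + Γ̄^α_{βγ} x^β_i x^γ_j`. -/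
def coordHessian (a : Fin (n + 1)) (i j : Fin n) (ξ : EuclideanSpace ℝ (Fin n)) : ℝ :=
  pd i (S.coordDeriv φ ψ a j) ξ
    - ∑ k, christoffel (S.inducedMetric φ ψ) k i j ξ * S.coordDeriv φ ψ a k ξ
    + ∑ b, ∑ c, christoffel (components g.form φ) a b c (S.coord φ ψ ξ)
        * S.coordDeriv φ ψ b i ξ * S.coordDeriv φ ψ c j ξ

/-- The second fundamental form `h_{ij} = -⟨x_{ij}, ν⟩`; since `σ = ⟨ν, ν⟩ = ±1`, this is the
tensor in the Gauss formula `x^α_{ij} = -σ h_{ij} ν^α`. -/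
def secondFundamentalForm (ξ : EuclideanSpace ℝ (Fin n)) : Matrix (Fin n) (Fin n) ℝ :=
  Matrix.of fun i j => -∑ a, ∑ b, components g.form φ (S.coord φ ψ ξ) a b
    * S.coordHessian φ ψ a i j ξ * S.normal φ ψ ξ b

end SpacelikeHypersurface

/-! ### Curvature functions -/

/-- `κ` lists the principal curvatures of `(h_{ij}, g_{ij})`: the eigenvalues of
`hⁱⱼ = gⁱᵏ h_{kj}`, with multiplicity, in some order. -/
def IsPrincipalCurvatures {n : ℕ} (h g : Matrix (Fin n) (Fin n) ℝ) (κ : Fin n → ℝ) : Prop :=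
  (g⁻¹ * h).charpoly.roots = Finset.univ.val.map κ

open Classical in
/-- A symmetric function `F` of the principal curvatures as a function `F(h_{ij}, g_{ij})` of the
second fundamental form and the metric. As `F` is symmetric, the order of the principal curvatures
is irrelevant. -/
def curvatureOperator {n : ℕ} (F : (Fin n → ℝ) → ℝ) (h g : Matrix (Fin n) (Fin n) ℝ) : ℝ :=
  if H : ∃ κ, IsPrincipalCurvatures h g κ then F H.choose else 0

/-- The symmetric matrix `½ (E_{ij} + E_{ji})`. -/
def symUnit {n : ℕ} (i j : Fin n) : Matrix (Fin n) (Fin n) ℝ :=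
  (1 / 2 : ℝ) • (Matrix.single i j 1 + Matrix.single j i 1)

/-- `Fⁱʲ = ∂F/∂h_{ij}`, the derivative being taken in the space of symmetric matrices, i.e.
`Fⁱʲ` is the symmetric tensor with `dF(η) = Fⁱʲ η_{ij}` for symmetric `η`. -/
def curvatureDeriv {n : ℕ} (F : (Fin n → ℝ) → ℝ) (h g : Matrix (Fin n) (Fin n) ℝ) :
    Matrix (Fin n) (Fin n) ℝ :=
  Matrix.of fun i j => deriv (fun t : ℝ => curvatureOperator F (h + t • symUnit i j) g) 0

/-- The hypersurface is admissible for a curvature function with domain of definition `Γ`: its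
principal curvatures lie in `Γ`. -/
def SpacelikeHypersurface.Admissible {n : ℕ} {N : Type*} [TopologicalSpace N]
    [ChartedSpace (EuclideanSpace ℝ (Fin (n + 1))) N] [IsManifold (𝓡 (n + 1)) 3 N]
    {g : SemiRiemannianMetric (n + 1) N}
    {M : Type*} [TopologicalSpace M] [ChartedSpace (EuclideanSpace ℝ (Fin n)) M]
    (S : SpacelikeHypersurface g M) (Γ : Set (Fin n → ℝ)) : Prop :=
  ∀ φ ∈ charts (n + 1) N, ∀ ψ ∈ charts n M, ∀ ξ ∈ S.domain φ ψ, ∀ κ,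
    IsPrincipalCurvatures (S.secondFundamentalForm φ ψ ξ) (S.inducedMetric φ ψ ξ) κ → κ ∈ Γ

/-- The curvature function `F`, defined in `Γ`, is of class `(D)`: for every admissible
hypersurface the tensor `Fⁱʲ = ∂F/∂h_{ij}`, evaluated at the hypersurface, exists and is
divergence free (in all local coordinates). -/
def IsClassD {n : ℕ} {N : Type u} [TopologicalSpace N]
    [ChartedSpace (EuclideanSpace ℝ (Fin (n + 1))) N] [IsManifold (𝓡 (n + 1)) 3 N]
    (g : SemiRiemannianMetric (n + 1) N) (F : (Fin n → ℝ) → ℝ) (Γ : Set (Fin n → ℝ)) : Prop :=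
  ∀ (M : Type v) [TopologicalSpace M] [ChartedSpace (EuclideanSpace ℝ (Fin n)) M]
    [IsManifold (𝓡 n) 3 M] (S : SpacelikeHypersurface g M), S.Admissible Γ →
    ∀ φ ∈ charts (n + 1) N, ∀ ψ ∈ charts n M, ∀ ξ ∈ S.domain φ ψ,
      (∀ i j, DifferentiableAt ℝ (fun t : ℝ => curvatureOperator F
          (S.secondFundamentalForm φ ψ ξ + t • symUnit i j) (S.inducedMetric φ ψ ξ)) 0) ∧
      DivergenceFreeAt (S.inducedMetric φ ψ)
        (fun ζ => curvatureDeriv F (S.secondFundamentalForm φ ψ ζ) (S.inducedMetric φ ψ ζ)) ξ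

/-- The elementary symmetric polynomial `H_k` of the principal curvatures. -/
def elemSymm (n k : ℕ) (κ : Fin n → ℝ) : ℝ :=
  ∑ s ∈ Finset.powersetCard k (Finset.univ : Finset (Fin n)), ∏ i ∈ s, κ i

/-- The cone of definition of `H_k`: all of `ℝⁿ` for the mean curvature `H₁`, and for `k ≥ 2` the
connected component of `{H_k > 0}` that contains `(1, …, 1)`, hence the positive cone. -/
def coneOfDefinition (n k : ℕ) : Set (Fin n → ℝ) :=
  if k = 1 then Set.univ else connectedComponentIn {κ | 0 < elemSymm n k κ} (fun _ => 1)

end CurvatureFlow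

end

noncomputable section

namespace CurvatureFlow

open Topology

/-! Write B = g⁻¹h for the shape operator, P = 1 - XB, and let N_k be the coefficient of X^k in adj
P. As det P = Σ (-1)^k H_k X^k, Jacobi's formula gives dH_{k+1}(η) = (-1)^k tr(N_k g⁻¹η), so F^{ij}
for H_{k+1} is (-1)^k N_k g⁻¹: up to sign, the Newton tensor with an index raised
(`curvatureDeriv_elemSymm`). The metric is parallel, so it suffices that N_k has zero divergence.

Comparing coefficients in adj P · P = det P gives N_{k+1} = N_k B + c_{k+1}·1, where c_{k+1} is the
coefficient of X^{k+1} in det P. Differentiating covariantly, the divergence of N_{k+1} is that of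
N_k contracted with B, plus N^j_l (B^l_{i;j} - B^l_{j;i}) (`sum_covMixed_newton_succ`). Everything
thus rests on the skew part of ∇B, which the Codazzi equation (`codazzi`, `covMixed_sub`) identifies
with ambient curvature terms R(ν, x_p, x_j, x_i).

In constant curvature R is K times the standard expression in the metric, and ν is orthogonal to
every x_j, so these terms vanish and induction on k settles all H_k. In an Einstein space they need
not vanish, but for H_2 only N_1 occurs, and N_0 = 1 leaves just the contraction of Codazzi. That
contraction is a Ricci curvature Ric(ν, x_i) = λ⟨ν, x_i⟩ = 0 up to sign
(`sum_riemannForm_of_einstein`).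

Two points need extra care. The normal is only assumed continuous, and its differentiability is
recovered in `diffV_normal`. Sectional curvature says nothing directly about degenerate planes,
which are reached by density in `riemannForm_of_sectionalCurvature`. -/

open Polynomial in
/-- At the point `s`, the coefficients of `p` are differentiable with derivative in the
direction `v` given by the coefficients of `q`. -/
def HasCoeffDeriv {F : Type*} [NormedAddCommGroup F] [NormedSpace ℝ F] (p : F → ℝ[X]) (q : ℝ[X])
    (s v : F) : Prop :=
  ∀ k, DifferentiableAt ℝ (fun z => (p z).coeff k) s ∧
    fderiv ℝ (fun z => (p z).coeff k) s v = q.coeff k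

/-! ### Jacobi's formula for matrices of polynomials. -/

namespace HasCoeffDeriv

open Polynomial

variable {F : Type*} [NormedAddCommGroup F] [NormedSpace ℝ F] {s v : F}

theorem const (p : ℝ[X]) : HasCoeffDeriv (fun _ : F => p) 0 s v := fun k => by
  simp

theorem mul {p₁ p₂ : F → ℝ[X]} {q₁ q₂ : ℝ[X]} (h₁ : HasCoeffDeriv p₁ q₁ s v)
    (h₂ : HasCoeffDeriv p₂ q₂ s v) :
    HasCoeffDeriv (fun z => p₁ z * p₂ z) (q₁ * p₂ s + p₁ s * q₂) s v := fun k => by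
  simp only [coeff_mul, coeff_add]
  refine ⟨DifferentiableAt.fun_sum fun x _ => (h₁ x.1).1.mul (h₂ x.2).1, ?_⟩
  rw [fderiv_fun_sum fun x _ => (h₁ x.1).1.mul (h₂ x.2).1, sum_apply,
    ← Finset.sum_add_distrib]
  refine Finset.sum_congr rfl fun x _ => ?_
  rw [fderiv_fun_mul (h₁ x.1).1 (h₂ x.2).1]
  simp only [add_apply, smul_apply, smul_eq_mul,
    (h₁ x.1).2, (h₂ x.2).2]
  ring

theorem sum {ι : Type*} (t : Finset ι) {p : ι → F → ℝ[X]} {q : ι → ℝ[X]}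
    (h : ∀ i ∈ t, HasCoeffDeriv (p i) (q i) s v) :
    HasCoeffDeriv (fun z => ∑ i ∈ t, p i z) (∑ i ∈ t, q i) s v := fun k => by
  simp only [finsetSum_coeff]
  refine ⟨DifferentiableAt.fun_sum fun i hi => (h i hi k).1, ?_⟩
  rw [fderiv_fun_sum fun i hi => (h i hi k).1, sum_apply]
  exact Finset.sum_congr rfl fun i hi => (h i hi k).2

theorem prod {ι : Type*} [DecidableEq ι] (t : Finset ι) {p : ι → F → ℝ[X]} {q : ι → ℝ[X]}
    (h : ∀ i ∈ t, HasCoeffDeriv (p i) (q i) s v) :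
    HasCoeffDeriv (fun z => ∏ i ∈ t, p i z) (∑ i ∈ t, (∏ j ∈ t.erase i, p j s) * q i) s v := by
  induction t using Finset.induction_on with
  | empty => simpa using const (s := s) (v := v) 1
  | insert a t ha ih =>
    have := (h a (Finset.mem_insert_self _ _)).mul
      (ih fun i hi => h i (Finset.mem_insert_of_mem hi))
    simp only [Finset.prod_insert ha]
    convert this using 1
    rw [Finset.sum_insert ha, Finset.erase_insert ha, mul_comm, Finset.mul_sum]
    congr 1
    refine Finset.sum_congr rfl fun i hi => ?_
    have hia : i ≠ a := fun h => ha (h ▸ hi)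
    rw [Finset.erase_insert_of_ne hia.symm,
      Finset.prod_insert (fun h => ha (Finset.mem_of_mem_erase h)), mul_assoc]

/-- Differentiating the Leibniz expansion one factor at a time and grouping by the column hit gives
determinants of P with one column replaced by that of Q. By Cramer's rule these are the diagonal
entries of adj(P) Q. -/
theorem det {n : ℕ} {P : F → Matrix (Fin n) (Fin n) ℝ[X]} {Q : Matrix (Fin n) (Fin n) ℝ[X]}
    (h : ∀ i j, HasCoeffDeriv (fun z => P z i j) (Q i j) s v) :
    HasCoeffDeriv (fun z => (P z).det) ((P s).adjugate * Q).trace s v := by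
  simp only [Matrix.det_apply']
  have := sum (Finset.univ : Finset (Equiv.Perm (Fin n))) fun σ _ =>
    (const (s := s) (v := v) ((σ.sign : ℤ) : ℝ[X])).mul
      (prod Finset.univ fun i _ => h (σ i) i)
  convert this using 1
  simp only [zero_mul, zero_add, Finset.mul_sum]
  rw [Finset.sum_comm, Matrix.trace]
  refine Finset.sum_congr rfl fun i _ => ?_
  have h₁ : ((P s).adjugate * Q).diag i = ((P s).updateCol i fun j => Q j i).det := by
    rw [← Matrix.cramer_apply, Matrix.cramer_eq_adjugate_mulVec]
    rfl
  rw [h₁, Matrix.det_apply']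
  refine Finset.sum_congr rfl fun σ _ => ?_
  rw [← Finset.mul_prod_erase Finset.univ _ (Finset.mem_univ i), Matrix.updateCol_self,
    mul_comm (Q (σ i) i)]
  congr 2
  refine Finset.prod_congr rfl fun k hk => ?_
  rw [Matrix.updateCol_ne (Finset.ne_of_mem_erase hk)]

end HasCoeffDeriv

/-! ### Newton tensors and the derivative of H_k with respect to the second fundamental form. -/

section Newton

open Polynomial

variable {n : ℕ}

/-- The coefficients of the adjugate of `1 - X A`. Up to the sign `(-1)ᵏ` these are the Newton
tensors of `A`. -/
def newton (k : ℕ) (A : Matrix (Fin n) (Fin n) ℝ) : Matrix (Fin n) (Fin n) ℝ :=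
  Matrix.of fun i j => ((1 - (X : ℝ[X]) • A.map C).adjugate i j).coeff k

theorem coeff_charpolyRev_zero (A : Matrix (Fin n) (Fin n) ℝ) : A.charpolyRev.coeff 0 = 1 := by
  rw [coeff_zero_eq_eval_zero, Matrix.eval_charpolyRev]

theorem newton_zero (A : Matrix (Fin n) (Fin n) ℝ) : newton 0 A = 1 := by
  have h := Matrix.adjugate_mul (1 - (X : ℝ[X]) • A.map C)
  rw [mul_sub, mul_one, Matrix.mul_smul] at h
  ext i j
  have h' := congrArg (fun p => p.coeff 0) (congrFun (congrFun h i) j)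
  have h₀ := coeff_charpolyRev_zero A
  rw [Matrix.charpolyRev] at h₀
  simp only [Matrix.sub_apply, Matrix.smul_apply, smul_eq_mul, coeff_sub, mul_coeff_zero,
    coeff_X_zero, zero_mul, sub_zero, h₀, one_mul] at h'
  rw [newton, Matrix.of_apply, h']
  by_cases hij : i = j <;> simp [hij, Matrix.one_apply]

/-- This is the coefficient of X^{k+1} in adj(P) P = det(P), P = 1 - XA. The mirror identity P
adj(P) = det(P) gives `newton_succ'`, and the two together show that the Newton tensors commute with
A. -/
theorem newton_succ (k : ℕ) (A : Matrix (Fin n) (Fin n) ℝ) :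
    newton (k + 1) A = newton k A * A + A.charpolyRev.coeff (k + 1) • 1 := by
  have h := Matrix.adjugate_mul (1 - (X : ℝ[X]) • A.map C)
  rw [mul_sub, mul_one, Matrix.mul_smul] at h
  ext i j
  have h' := congrArg (fun p => p.coeff (k + 1)) (congrFun (congrFun h i) j)
  simp only [Matrix.sub_apply, Matrix.smul_apply, smul_eq_mul, coeff_sub, coeff_X_mul,
    Matrix.mul_apply, finsetSum_coeff, Matrix.map_apply, coeff_mul_C] at h'
  simp only [Matrix.add_apply, Matrix.mul_apply, Matrix.smul_apply, newton, Matrix.of_apply,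
    smul_eq_mul]
  rw [sub_eq_iff_eq_add'] at h'
  rw [h', Matrix.charpolyRev]
  by_cases hij : i = j <;> simp [hij, Matrix.one_apply]

theorem newton_succ' (k : ℕ) (A : Matrix (Fin n) (Fin n) ℝ) :
    newton (k + 1) A = A * newton k A + A.charpolyRev.coeff (k + 1) • 1 := by
  have h := Matrix.mul_adjugate (1 - (X : ℝ[X]) • A.map C)
  rw [sub_mul, one_mul, Matrix.smul_mul] at h
  ext i j
  have h' := congrArg (fun p => p.coeff (k + 1)) (congrFun (congrFun h i) j)
  simp only [Matrix.sub_apply, Matrix.smul_apply, smul_eq_mul, coeff_sub, coeff_X_mul,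
    Matrix.mul_apply, finsetSum_coeff, Matrix.map_apply, coeff_C_mul] at h'
  simp only [Matrix.add_apply, Matrix.mul_apply, Matrix.smul_apply, newton, Matrix.of_apply,
    smul_eq_mul]
  rw [sub_eq_iff_eq_add'] at h'
  rw [h', Matrix.charpolyRev]
  by_cases hij : i = j <;> simp [hij, Matrix.one_apply]

theorem newton_comm (k : ℕ) (A : Matrix (Fin n) (Fin n) ℝ) : newton k A * A = A * newton k A :=
  add_right_cancel ((newton_succ k A).symm.trans (newton_succ' k A))

/-- By induction, transposing g⁻¹h N_k g⁻¹ gives N_k g⁻¹ h g⁻¹, and N_k commutes with g⁻¹h. This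
symmetry identifies N_k g⁻¹ with the symmetric tensor F^{ij} and later lets the divergence be taken
on either index. -/
theorem newton_mul_inv_transpose {h g : Matrix (Fin n) (Fin n) ℝ} (hh : h.IsSymm) (hg : g.IsSymm)
    (k : ℕ) : (newton k (g⁻¹ * h) * g⁻¹).transpose = newton k (g⁻¹ * h) * g⁻¹ := by
  have hg' : (g⁻¹).transpose = g⁻¹ := by rw [Matrix.transpose_nonsing_inv, hg.eq]
  induction k with
  | zero => rw [newton_zero, one_mul, hg']
  | succ k ih =>
    rw [newton_succ', add_mul, Matrix.transpose_add, smul_mul_assoc, one_mul,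
      Matrix.transpose_smul, hg', mul_assoc (g⁻¹ * h), Matrix.transpose_mul, ih,
      Matrix.transpose_mul, hg', hh.eq, mul_assoc, ← mul_assoc g⁻¹ h, ← mul_assoc,
      newton_comm, mul_assoc]

/-- The derivative of the elementary symmetric polynomials of the eigenvalues of a matrix. -/
theorem fderiv_coeff_charpolyRev {F : Type*} [NormedAddCommGroup F] [NormedSpace ℝ F]
    {A : F → Matrix (Fin n) (Fin n) ℝ} {s : F}
    (hA : ∀ i j, DifferentiableAt ℝ (fun z => A z i j) s) (k : ℕ) :
    DifferentiableAt ℝ (fun z => (A z).charpolyRev.coeff (k + 1)) s ∧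
    ∀ v, fderiv ℝ (fun z => (A z).charpolyRev.coeff (k + 1)) s v =
      -(newton k (A s) * Matrix.of fun i j => fderiv ℝ (fun z => A z i j) s v).trace := by
  have H : ∀ v, HasCoeffDeriv (fun z => (A z).charpolyRev)
      ((1 - (X : ℝ[X]) • (A s).map C).adjugate *
        -((X : ℝ[X]) • (Matrix.of fun i j => fderiv ℝ (fun z => A z i j) s v).map C)).trace s v := by
    intro v
    refine HasCoeffDeriv.det (P := fun z => 1 - (X : ℝ[X]) • (A z).map C) fun i j m => ?_
    have hc : ∀ z, ((1 - (X : ℝ[X]) • (A z).map C) i j).coeff m =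
        ((1 : Matrix (Fin n) (Fin n) ℝ[X]) i j).coeff m - if m = 1 then A z i j else 0 := by
      intro z
      rw [Matrix.sub_apply, coeff_sub, Matrix.smul_apply, Matrix.map_apply, smul_eq_mul, X_mul_C,
        coeff_C_mul, coeff_X]
      simp [eq_comm]
    simp only [hc, Matrix.neg_apply, Matrix.smul_apply, Matrix.map_apply, smul_eq_mul, X_mul_C,
        coeff_C_mul, coeff_X, coeff_neg, Matrix.of_apply]
    by_cases hm : m = 1
    · simp only [hm, if_true]
      refine ⟨(differentiableAt_const _).sub (hA i j), ?_⟩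
      rw [fderiv_const_sub]
      simp
    · simp [hm, Ne.symm hm]
  -- Differentiability of the coefficients does not involve the direction, so the direction 0
  -- serves. In the formula, the derivative of 1 - XA carries a factor X, which shifts the
  -- coefficient k + 1 of the trace to the coefficient k of the adjugate.
  refine ⟨(H 0 (k + 1)).1, fun v => ?_⟩
  rw [(H v (k + 1)).2, Matrix.mul_neg, Matrix.trace_neg, Matrix.mul_smul, Matrix.trace_smul,
    smul_eq_mul, coeff_neg, coeff_X_mul, neg_inj, Matrix.trace, Matrix.trace, finsetSum_coeff]
  refine Finset.sum_congr rfl fun i _ => ?_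
  simp only [Matrix.diag_apply, Matrix.mul_apply, finsetSum_coeff, Matrix.map_apply, coeff_mul_C]
  rfl

theorem differentiableAt_newton {F : Type*} [NormedAddCommGroup F] [NormedSpace ℝ F]
    {A : F → Matrix (Fin n) (Fin n) ℝ} {s : F}
    (hA : ∀ i j, DifferentiableAt ℝ (fun z => A z i j) s) (k : ℕ) (i j : Fin n) :
    DifferentiableAt ℝ (fun z => newton k (A z) i j) s := by
  induction k generalizing i j with
  | zero => simp only [newton_zero]; exact differentiableAt_const _
  | succ k ih =>
    simp only [newton_succ, Matrix.add_apply, Matrix.mul_apply, Matrix.smul_apply, smul_eq_mul]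
    exact (DifferentiableAt.fun_sum fun l _ => (ih i l).mul (hA l j)).add
      ((fderiv_coeff_charpolyRev hA k).1.mul (differentiableAt_const _))

/-- Vieta's formula: the list κ exhausts n roots, so the characteristic polynomial splits, and the
coefficient k of its reverse is its coefficient n - k. The right side does not see κ, so any choice
of principal curvatures gives the same value. -/
theorem elemSymm_of_isPrincipalCurvatures {h g : Matrix (Fin n) (Fin n) ℝ} {κ : Fin n → ℝ}
    (hκ : IsPrincipalCurvatures h g κ) (k : ℕ) (hk : k ≤ n) :
    elemSymm n k κ = (-1) ^ k * (g⁻¹ * h).charpolyRev.coeff k := by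
  have hc : (g⁻¹ * h).charpoly.natDegree = n := by simp
  have hr : (g⁻¹ * h).charpoly.roots.card = (g⁻¹ * h).charpoly.natDegree := by
    rw [hc, hκ]; simp
  rw [← Matrix.reverse_charpoly, coeff_reverse, revAt_le (by rw [hc]; exact hk),
    coeff_eq_esymm_roots_of_card hr (Nat.sub_le _ _), hκ, Finset.esymm_map_val,
    (Matrix.charpoly_monic _).leadingCoeff, hc, Nat.sub_sub_self hk, one_mul, ← mul_assoc,
    ← mul_pow]
  simp [elemSymm]

/-- With g = BᵀB, the matrix g⁻¹h is similar to the symmetric matrix B⁻ᵀ h B⁻¹, whose eigenvalues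
are real. Hence `curvatureOperator` never falls back to its default value 0 on symmetric h and
positive definite g. -/
theorem exists_isPrincipalCurvatures {h g : Matrix (Fin n) (Fin n) ℝ} (hh : h.IsSymm)
    (hg : g.PosDef) : ∃ κ, IsPrincipalCurvatures h g κ := by
  open scoped MatrixOrder in
  obtain ⟨B, hB⟩ := CStarAlgebra.nonneg_iff_eq_star_mul_self.mp hg.posSemidef.nonneg
  have hgu : IsUnit g.det := (Matrix.isUnit_iff_isUnit_det _).1 hg.isUnit
  rw [Matrix.star_eq_conjTranspose, Matrix.conjTranspose_eq_transpose_of_trivial] at hB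
  have hBu : IsUnit B.det := by
    rw [hB, Matrix.det_mul, Matrix.det_transpose] at hgu
    exact isUnit_of_mul_isUnit_left hgu
  have hB1 : B * B⁻¹ = 1 := Matrix.mul_nonsing_inv _ hBu
  have hS : (B⁻¹.transpose * h * B⁻¹).IsHermitian := by
    rw [Matrix.IsHermitian, Matrix.conjTranspose_eq_transpose_of_trivial]
    simp only [Matrix.transpose_mul, Matrix.transpose_transpose, hh.eq, mul_assoc]
  refine ⟨hS.eigenvalues, ?_⟩
  have hcp : (g⁻¹ * h).charpoly = (B⁻¹.transpose * h * B⁻¹).charpoly := by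
    rw [Matrix.charpoly_mul_comm (B⁻¹.transpose * h), hB, Matrix.mul_inv_rev,
      ← Matrix.transpose_nonsing_inv, mul_assoc]
  rw [IsPrincipalCurvatures, hcp, hS.roots_charpoly_eq_eigenvalues]
  simp

theorem curvatureOperator_elemSymm {h g : Matrix (Fin n) (Fin n) ℝ} (hh : h.IsSymm)
    (hg : g.PosDef) (k : ℕ) (hk : k ≤ n) :
    curvatureOperator (elemSymm n k) h g = (-1) ^ k * (g⁻¹ * h).charpolyRev.coeff k := by
  have H := exists_isPrincipalCurvatures hh hg
  rw [curvatureOperator, dif_pos H, elemSymm_of_isPrincipalCurvatures H.choose_spec k hk]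

theorem symUnit_isSymm (i j : Fin n) : (symUnit i j).IsSymm := by
  rw [symUnit, Matrix.IsSymm, Matrix.transpose_smul, Matrix.transpose_add,
    Matrix.transpose_single, Matrix.transpose_single, add_comm]

theorem trace_mul_symUnit (M : Matrix (Fin n) (Fin n) ℝ) (hM : M.IsSymm) (i j : Fin n) :
    (M * symUnit i j).trace = M i j := by
  rw [symUnit, Matrix.mul_smul, Matrix.mul_add, Matrix.trace_smul, Matrix.trace_add,
    Matrix.trace_mul_single, Matrix.trace_mul_single]
  simp only [hM.apply]
  simp
  ring

/-- The perturbed matrix stays symmetric for every t, so the operator agrees along the whole line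
with a coefficient of `charpolyRev`, and Jacobi's formula applies. -/
theorem curvatureOperator_elemSymm_deriv {h g : Matrix (Fin n) (Fin n) ℝ} (hh : h.IsSymm)
    (hg : g.PosDef) (k : ℕ) (hk : k + 1 ≤ n) (i j : Fin n) :
    HasDerivAt (fun t : ℝ => curvatureOperator (elemSymm n (k + 1)) (h + t • symUnit i j) g)
      ((-1) ^ k * (newton k (g⁻¹ * h) * g⁻¹) i j) 0 := by
  have hf : (fun t : ℝ => curvatureOperator (elemSymm n (k + 1)) (h + t • symUnit i j) g) =
      fun t => (-1) ^ (k + 1) * (g⁻¹ * (h + t • symUnit i j)).charpolyRev.coeff (k + 1) := by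
    funext t
    exact curvatureOperator_elemSymm (hh.add ((symUnit_isSymm i j).smul t)) hg _ hk
  have hA : ∀ a b (t : ℝ), (g⁻¹ * (h + t • symUnit i j)) a b =
      (g⁻¹ * h) a b + t * (g⁻¹ * symUnit i j) a b := by
    intro a b t
    rw [mul_add, Matrix.mul_smul, Matrix.add_apply, Matrix.smul_apply, smul_eq_mul]
  have hd : ∀ a b, HasDerivAt (fun t : ℝ => (g⁻¹ * (h + t • symUnit i j)) a b)
      ((g⁻¹ * symUnit i j) a b) 0 := by
    intro a b
    simp only [hA]
    simpa using ((hasDerivAt_id (0 : ℝ)).mul_const ((g⁻¹ * symUnit i j) a b)).const_add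
      ((g⁻¹ * h) a b)
  obtain ⟨h₁, h₂⟩ := fderiv_coeff_charpolyRev (fun a b => (hd a b).differentiableAt) k
  rw [hf]
  refine (h₁.hasDerivAt.const_mul ((-1) ^ (k + 1))).congr_deriv ?_
  rw [← fderiv_apply_one_eq_deriv, h₂]
  have : (Matrix.of fun a b => fderiv ℝ (fun t : ℝ => (g⁻¹ * (h + t • symUnit i j)) a b) 0 1) =
      g⁻¹ * symUnit i j := by
    ext a b
    rw [Matrix.of_apply, fderiv_apply_one_eq_deriv, (hd a b).deriv]
  rw [this, zero_smul, add_zero, ← mul_assoc, trace_mul_symUnit _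
    (newton_mul_inv_transpose hh (by simpa using hg.isHermitian) k)]
  ring

theorem curvatureDeriv_elemSymm {h g : Matrix (Fin n) (Fin n) ℝ} (hh : h.IsSymm)
    (hg : g.PosDef) (k : ℕ) (hk : k + 1 ≤ n) :
    curvatureDeriv (elemSymm n (k + 1)) h g = (-1 : ℝ) ^ k • (newton k (g⁻¹ * h) * g⁻¹) := by
  ext i j
  rw [curvatureDeriv, Matrix.of_apply, (curvatureOperator_elemSymm_deriv hh hg k hk i j).deriv]
  rfl

end Newton

/-! ### Rules for partial derivatives. -/

section PartialDerivatives

variable {m n : ℕ} {f h : EuclideanSpace ℝ (Fin m) → ℝ} {y : EuclideanSpace ℝ (Fin m)}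

theorem pd_congr (i : Fin m) (hfh : f =ᶠ[𝓝 y] h) : pd i f y = pd i h y := by
  rw [pd, pd, hfh.fderiv_eq]

theorem pd_const (i : Fin m) (c : ℝ) : pd i (fun _ => c) y = 0 := by simp [pd]

theorem pd_add (i : Fin m) (hf : DifferentiableAt ℝ f y) (hh : DifferentiableAt ℝ h y) :
    pd i (fun z => f z + h z) y = pd i f y + pd i h y := by
  rw [pd, fderiv_fun_add hf hh]; rfl

theorem pd_neg (i : Fin m) : pd i (fun z => -f z) y = -pd i f y := by
  rw [pd, fderiv_fun_neg]; rfl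

theorem pd_mul (i : Fin m) (hf : DifferentiableAt ℝ f y) (hh : DifferentiableAt ℝ h y) :
    pd i (fun z => f z * h z) y = pd i f y * h y + f y * pd i h y := by
  rw [pd, fderiv_fun_mul hf hh, add_apply, smul_apply, smul_apply, pd, pd, smul_eq_mul, smul_eq_mul]
  ring

theorem pd_sum {ι : Type*} (i : Fin m) (t : Finset ι) {f : ι → EuclideanSpace ℝ (Fin m) → ℝ}
    (hf : ∀ a ∈ t, DifferentiableAt ℝ (f a) y) :
    pd i (fun z => ∑ a ∈ t, f a z) y = ∑ a ∈ t, pd i (f a) y := by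
  rw [pd, fderiv_fun_sum hf, sum_apply]; rfl

theorem pd_coord {X : EuclideanSpace ℝ (Fin n) → EuclideanSpace ℝ (Fin m)}
    {ξ : EuclideanSpace ℝ (Fin n)} (hX : DifferentiableAt ℝ X ξ) (i : Fin n) (a : Fin m) :
    pd i (fun ζ => X ζ a) ξ = fderiv ℝ X ξ (EuclideanSpace.single i 1) a := by
  have := ((EuclideanSpace.proj a : EuclideanSpace ℝ (Fin m) →L[ℝ] ℝ).hasFDerivAt.comp ξ
    hX.hasFDerivAt).fderiv
  rw [pd]
  exact congrArg (fun L => L (EuclideanSpace.single i 1)) this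

theorem pd_comp {X : EuclideanSpace ℝ (Fin n) → EuclideanSpace ℝ (Fin m)}
    {ξ : EuclideanSpace ℝ (Fin n)} (i : Fin n) (hf : DifferentiableAt ℝ f (X ξ))
    (hX : DifferentiableAt ℝ X ξ) :
    pd i (fun ζ => f (X ζ)) ξ = ∑ a, pd i (fun ζ => X ζ a) ξ * pd a f (X ξ) := by
  have h₁ : pd i (fun ζ => f (X ζ)) ξ =
      fderiv ℝ f (X ξ) (fderiv ℝ X ξ (EuclideanSpace.single i 1)) := by
    rw [pd, fderiv_fun_comp (𝕜 := ℝ) ξ hf hX]; rfl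
  simp only [pd_coord hX, h₁]
  set w := fderiv ℝ X ξ (EuclideanSpace.single i 1)
  have hw : w = ∑ a, w a • EuclideanSpace.single a (1 : ℝ) := by
    ext b
    simp [Finset.sum_apply, Pi.single_apply]
  conv_lhs => rw [hw]
  rw [map_sum]
  simp only [map_smul, smul_eq_mul, pd]

theorem contDiffAt_pd {k l : ℕ∞ω} (hf : ContDiffAt ℝ k f y) (hkl : l + 1 ≤ k) (i : Fin m) :
    ContDiffAt ℝ l (pd i f) y :=
  (hf.fderiv_right hkl).clm_apply contDiffAt_const

theorem pd_comm (hf : ContDiffAt ℝ 2 f y) (i j : Fin m) : pd i (pd j f) y = pd j (pd i f) y := by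
  have hd : DifferentiableAt ℝ (fderiv ℝ f) y :=
    (hf.fderiv_right (m := 1) (by norm_num)).differentiableAt (by norm_num)
  have h : ∀ i j, pd i (pd j f) y =
      fderiv ℝ (fderiv ℝ f) y (EuclideanSpace.single i 1) (EuclideanSpace.single j 1) := by
    intro i j
    change fderiv ℝ (fun z => fderiv ℝ f z (EuclideanSpace.single j 1)) y _ = _
    rw [fderiv_clm_apply hd (differentiableAt_const _)]
    simp
  rw [h, h]
  exact hf.isSymmSndFDerivAt (by simp) _ _

end PartialDerivatives

/-! ### Entrywise calculus of matrix and vector valued functions. -/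

section MatrixCalculus

variable {m : ℕ} {ι κ μ : Type*}
  {y : EuclideanSpace ℝ (Fin m)}

/-- The entrywise partial derivative of a matrix valued function. -/
def pdM (i : Fin m) (A : EuclideanSpace ℝ (Fin m) → Matrix ι κ ℝ) (y : EuclideanSpace ℝ (Fin m)) :
    Matrix ι κ ℝ :=
  Matrix.of fun a b => pd i (fun z => A z a b) y

/-- The componentwise partial derivative of a vector valued function. -/
def pdV (i : Fin m) (V : EuclideanSpace ℝ (Fin m) → ι → ℝ) (y : EuclideanSpace ℝ (Fin m)) : ι → ℝ :=
  fun a => pd i (fun z => V z a) y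

/-- A matrix valued function whose entries are differentiable. -/
def DiffM (A : EuclideanSpace ℝ (Fin m) → Matrix ι κ ℝ) (y : EuclideanSpace ℝ (Fin m)) : Prop :=
  ∀ a b, DifferentiableAt ℝ (fun z => A z a b) y

/-- A vector valued function whose components are differentiable. -/
def DiffV (V : EuclideanSpace ℝ (Fin m) → ι → ℝ) (y : EuclideanSpace ℝ (Fin m)) : Prop :=
  ∀ a, DifferentiableAt ℝ (fun z => V z a) y

theorem DiffM.mul [Fintype κ] {A : EuclideanSpace ℝ (Fin m) → Matrix ι κ ℝ}
    {B : EuclideanSpace ℝ (Fin m) → Matrix κ μ ℝ} (hA : DiffM A y) (hB : DiffM B y) :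
    DiffM (fun z => A z * B z) y := fun a b => by
  simp only [Matrix.mul_apply]
  exact DifferentiableAt.fun_sum fun c _ => (hA a c).mul (hB c b)

theorem DiffM.transpose {A : EuclideanSpace ℝ (Fin m) → Matrix ι κ ℝ} (hA : DiffM A y) :
    DiffM (fun z => (A z).transpose) y := fun a b => hA b a

theorem DiffM.mulVec [Fintype κ] {A : EuclideanSpace ℝ (Fin m) → Matrix ι κ ℝ}
    {V : EuclideanSpace ℝ (Fin m) → κ → ℝ} (hA : DiffM A y) (hV : DiffV V y) :
    DiffV (fun z => (A z).mulVec (V z)) y := fun a => by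
  simp only [Matrix.mulVec, dotProduct]
  exact DifferentiableAt.fun_sum fun c _ => (hA a c).mul (hV c)

theorem DiffV.dotProduct [Fintype ι] {V W : EuclideanSpace ℝ (Fin m) → ι → ℝ} (hV : DiffV V y)
    (hW : DiffV W y) : DifferentiableAt ℝ (fun z => V z ⬝ᵥ W z) y :=
  DifferentiableAt.fun_sum fun c _ => (hV c).mul (hW c)

theorem DiffV.add {V W : EuclideanSpace ℝ (Fin m) → ι → ℝ} (hV : DiffV V y)
    (hW : DiffV W y) : DiffV (fun z => V z + W z) y := fun a => (hV a).add (hW a)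

theorem pdM_mul [Fintype κ] (i : Fin m) {A : EuclideanSpace ℝ (Fin m) → Matrix ι κ ℝ}
    {B : EuclideanSpace ℝ (Fin m) → Matrix κ μ ℝ} (hA : DiffM A y) (hB : DiffM B y) :
    pdM i (fun z => A z * B z) y = pdM i A y * B y + A y * pdM i B y := by
  ext a b
  simp only [pdM, Matrix.mul_apply, Matrix.of_apply, Matrix.add_apply]
  rw [pd_sum i _ fun c _ => (hA a c).fun_mul (hB c b), ← Finset.sum_add_distrib]
  exact Finset.sum_congr rfl fun c _ => pd_mul i (hA a c) (hB c b)

theorem pdM_add (i : Fin m) {A B : EuclideanSpace ℝ (Fin m) → Matrix ι κ ℝ}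
    (hA : DiffM A y) (hB : DiffM B y) :
    pdM i (fun z => A z + B z) y = pdM i A y + pdM i B y := by
  ext a b
  exact pd_add i (hA a b) (hB a b)

theorem pdM_transpose (i : Fin m) (A : EuclideanSpace ℝ (Fin m) → Matrix ι κ ℝ) :
    pdM i (fun z => (A z).transpose) y = (pdM i A y).transpose := rfl

theorem pdM_congr (i : Fin m) {A B : EuclideanSpace ℝ (Fin m) → Matrix ι κ ℝ}
    (h : ∀ᶠ z in 𝓝 y, A z = B z) : pdM i A y = pdM i B y := by
  ext a b
  exact pd_congr i (h.mono fun z hz => congrFun (congrFun hz a) b)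

theorem pdV_add (i : Fin m) {V W : EuclideanSpace ℝ (Fin m) → ι → ℝ} (hV : DiffV V y)
    (hW : DiffV W y) : pdV i (fun z => V z + W z) y = pdV i V y + pdV i W y := by
  ext a
  exact pd_add i (hV a) (hW a)

theorem pdV_mulVec [Fintype κ] (i : Fin m) {A : EuclideanSpace ℝ (Fin m) → Matrix ι κ ℝ}
    {V : EuclideanSpace ℝ (Fin m) → κ → ℝ} (hA : DiffM A y) (hV : DiffV V y) :
    pdV i (fun z => (A z).mulVec (V z)) y = (pdM i A y).mulVec (V y) + (A y).mulVec (pdV i V y) := by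
  ext a
  simp only [pdV, Matrix.mulVec, dotProduct, Pi.add_apply]
  rw [pd_sum i _ fun c _ => (hA a c).fun_mul (hV c), ← Finset.sum_add_distrib]
  exact Finset.sum_congr rfl fun c _ => pd_mul i (hA a c) (hV c)

theorem pd_dotProduct [Fintype ι] (i : Fin m) {V W : EuclideanSpace ℝ (Fin m) → ι → ℝ} (hV : DiffV V y)
    (hW : DiffV W y) :
    pd i (fun z => V z ⬝ᵥ W z) y = pdV i V y ⬝ᵥ W y + V y ⬝ᵥ pdV i W y := by
  simp only [dotProduct]
  rw [pd_sum i _ fun c _ => (hV c).fun_mul (hW c), ← Finset.sum_add_distrib]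
  exact Finset.sum_congr rfl fun c _ => pd_mul i (hV c) (hW c)

variable [Fintype ι] [DecidableEq ι]

theorem contDiffAt_det {k : ℕ∞ω} {A : EuclideanSpace ℝ (Fin m) → Matrix ι ι ℝ}
    (hA : ∀ a b, ContDiffAt ℝ k (fun z => A z a b) y) : ContDiffAt ℝ k (fun z => (A z).det) y := by
  simp only [Matrix.det_apply']
  exact ContDiffAt.sum fun σ _ => contDiffAt_const.mul (contDiffAt_prod fun a _ => hA _ _)

theorem contDiffAt_inv_apply {k : ℕ∞ω} {A : EuclideanSpace ℝ (Fin m) → Matrix ι ι ℝ}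
    (hA : ∀ a b, ContDiffAt ℝ k (fun z => A z a b) y) (h : (A y).det ≠ 0) (a b : ι) :
    ContDiffAt ℝ k (fun z => (A z)⁻¹ a b) y := by
  simp only [Matrix.inv_def, Ring.inverse_eq_inv', Matrix.smul_apply, smul_eq_mul,
    Matrix.adjugate_apply]
  refine ((contDiffAt_det hA).inv h).mul (contDiffAt_det fun c d => ?_)
  simp only [Matrix.updateRow_apply]
  split_ifs
  · exact contDiffAt_const
  · exact hA c d

theorem eventually_det_ne_zero {A : EuclideanSpace ℝ (Fin m) → Matrix ι ι ℝ}
    (hA : ∀ a b, ContinuousAt (fun z => A z a b) y) (h : (A y).det ≠ 0) :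
    ∀ᶠ z in 𝓝 y, (A z).det ≠ 0 := by
  have : ContinuousAt A y := continuousAt_pi.2 fun a => continuousAt_pi.2 fun b => hA a b
  exact ((continuous_id.matrix_det (n := ι) (R := ℝ)).continuousAt.comp this).eventually_ne h

theorem DiffM.inv {A : EuclideanSpace ℝ (Fin m) → Matrix ι ι ℝ} (hA : DiffM A y)
    (h : (A y).det ≠ 0) : DiffM (fun z => (A z)⁻¹) y := fun a b => by
  simp only [Matrix.inv_def, Ring.inverse_eq_inv', Matrix.smul_apply, smul_eq_mul,
    Matrix.adjugate_apply]
  have hdet : ∀ B : EuclideanSpace ℝ (Fin m) → Matrix ι ι ℝ, DiffM B y →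
      DifferentiableAt ℝ (fun z => (B z).det) y := by
    intro B hB
    simp only [Matrix.det_apply']
    refine DifferentiableAt.fun_sum fun σ _ => (differentiableAt_const _).mul ?_
    exact (HasFDerivAt.finsetProd (g := fun a z => B z (σ a) a)
      fun a _ => (hB (σ a) a).hasFDerivAt).differentiableAt
  refine ((hdet A hA).inv h).mul (hdet _ fun c d => ?_)
  simp only [Matrix.updateRow_apply]
  split_ifs
  · exact differentiableAt_const _
  · exact hA c d

theorem pdM_inv (i : Fin m) {A : EuclideanSpace ℝ (Fin m) → Matrix ι ι ℝ} (hA : DiffM A y)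
    (h : (A y).det ≠ 0) :
    pdM i (fun z => (A z)⁻¹) y = -((A y)⁻¹ * pdM i A y * (A y)⁻¹) := by
  have h1 : ∀ᶠ z in 𝓝 y, A z * (A z)⁻¹ = (1 : Matrix ι ι ℝ) :=
    (eventually_det_ne_zero (fun a b => (hA a b).continuousAt) h).mono fun z hz =>
      Matrix.mul_nonsing_inv _ hz.isUnit
  have h2 := pdM_congr i h1
  have h3 : pdM i (fun _ => (1 : Matrix ι ι ℝ)) y = 0 := by
    ext a b
    exact pd_const i _
  rw [pdM_mul i hA (hA.inv h), h3] at h2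
  have h4 := congrArg (fun M => (A y)⁻¹ * M) h2
  simp only [mul_add, mul_zero, ← mul_assoc, Matrix.nonsing_inv_mul _ h.isUnit, one_mul] at h4
  exact eq_neg_of_add_eq_zero_right h4

end MatrixCalculus

/-! ### The Levi-Civita connection and the symmetries of the curvature tensor. -/

section Christoffel

variable {m : ℕ} {G : EuclideanSpace ℝ (Fin m) → Matrix (Fin m) (Fin m) ℝ}
  {y : EuclideanSpace ℝ (Fin m)}

/-- The matrix `(Γᵃ_{cb})_{ab}`. -/
def chrM (G : EuclideanSpace ℝ (Fin m) → Matrix (Fin m) (Fin m) ℝ) (c : Fin m)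
    (y : EuclideanSpace ℝ (Fin m)) : Matrix (Fin m) (Fin m) ℝ :=
  Matrix.of fun a b => christoffel G a c b y

theorem christoffel_symm (hG : ∀ z, (G z).IsSymm) (k i j : Fin m) :
    christoffel G k i j = christoffel G k j i := by
  funext y
  rw [christoffel, christoffel]
  congr 1
  refine Finset.sum_congr rfl fun l _ => ?_
  have : (fun z => G z i j) = fun z => G z j i := funext fun z => (hG z).apply _ _
  rw [this]
  ring

theorem sum_mul_christoffel (h : (G y).det ≠ 0) (l i j : Fin m) :
    ∑ e, G y l e * christoffel G e i j y = (1 / 2) *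
      (pd i (fun z => G z j l) y + pd j (fun z => G z i l) y - pd l (fun z => G z i j) y) := by
  have h1 := Matrix.mul_nonsing_inv _ h.isUnit
  set f : Fin m → ℝ := fun l =>
    pd i (fun z => G z j l) y + pd j (fun z => G z i l) y - pd l (fun z => G z i j) y with hf
  have hc : ∀ e, christoffel G e i j y = (1 / 2) * ((G y)⁻¹.mulVec f) e := fun e => rfl
  have : ∑ e, G y l e * christoffel G e i j y = (1 / 2) * ((G y).mulVec ((G y)⁻¹.mulVec f)) l := by
    simp only [hc]
    rw [Matrix.mulVec, dotProduct, Finset.mul_sum]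
    exact Finset.sum_congr rfl fun e _ => by ring
  rw [this, Matrix.mulVec_mulVec, h1, Matrix.one_mulVec]

/-- The metric is parallel. -/
theorem pdM_metric (hG : ∀ z, (G z).IsSymm) (h : (G y).det ≠ 0) (c : Fin m) :
    pdM c G y = (chrM G c y).transpose * G y + G y * chrM G c y := by
  ext a b
  have h1 := sum_mul_christoffel h a c b
  have h2 := sum_mul_christoffel h b c a
  have hs : ∀ a b, (fun z => G z a b) = fun z => G z b a :=
    fun a b => funext fun z => (hG z).apply _ _
  simp only [pdM, chrM, Matrix.of_apply, Matrix.add_apply, Matrix.mul_apply, Matrix.transpose_apply]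
  have h3 : ∑ e, christoffel G e c a y * G y e b = ∑ e, G y b e * christoffel G e c a y :=
    Finset.sum_congr rfl fun e _ => by rw [mul_comm, (hG y).apply]
  rw [h3, h1, h2, hs b a, hs c b, hs c a]
  ring

theorem contDiffAt_christoffel (hG : ∀ a b, ContDiffAt ℝ 2 (fun z => G z a b) y)
    (h : (G y).det ≠ 0) (k i j : Fin m) : ContDiffAt ℝ 1 (christoffel G k i j) y := by
  have hp : ∀ i a b, ContDiffAt ℝ 1 (pd i fun z => G z a b) y := fun i a b =>
    contDiffAt_pd (hG a b) (by norm_num) i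
  have hi : ∀ a b, ContDiffAt ℝ 1 (fun z => (G z)⁻¹ a b) y :=
    contDiffAt_inv_apply (fun a b => (hG a b).of_le (by norm_num)) h
  exact contDiffAt_const.mul (ContDiffAt.sum fun l _ => (hi k l).mul
    (((hp i j l).add (hp j i l)).sub (hp l i j)))

theorem diffM_chrM (hG : ∀ a b, ContDiffAt ℝ 2 (fun z => G z a b) y)
    (h : (G y).det ≠ 0) (c : Fin m) : DiffM (chrM G c) y := fun a b =>
  (contDiffAt_christoffel hG h a c b).differentiableAt (by norm_num)

/-- In terms of connection matrices the curvature is ∂_cΓ_d - ∂_dΓ_c + [Γ_c, Γ_d]. Symmetry of the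
Christoffel symbols reconciles the two index conventions. -/
theorem riemannUp_eq (hG : ∀ z, (G z).IsSymm) (a b c d : Fin m) :
    riemannUp G a b c d y = (pdM c (chrM G d) y - pdM d (chrM G c) y +
      (chrM G c y * chrM G d y - chrM G d y * chrM G c y)) a b := by
  simp only [riemannUp, pdM, chrM, Matrix.add_apply, Matrix.sub_apply, Matrix.mul_apply,
    Matrix.of_apply, Finset.sum_sub_distrib]
  have h := fun a b c => christoffel_symm (G := G) hG a b c
  rw [h a b d, h a b c]
  simp only [h _ b _]

theorem riemann_eq (hG : ∀ z, (G z).IsSymm) (a b c d : Fin m) :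
    riemann G a b c d y = (G y * (pdM c (chrM G d) y - pdM d (chrM G c) y +
      (chrM G c y * chrM G d y - chrM G d y * chrM G c y))) a b := by
  simp only [riemann, riemannUp_eq hG, Matrix.mul_apply]

theorem riemann_swap_right (a b c d : Fin m) : riemann G a b c d y = -riemann G a b d c y := by
  simp only [riemann, riemannUp, ← Finset.sum_neg_distrib, Finset.sum_sub_distrib]
  exact Finset.sum_congr rfl fun e _ => by ring

theorem riemann_cyclic (hG : ∀ z, (G z).IsSymm) (a b c d : Fin m) :
    riemann G a b c d y + riemann G a c d b y + riemann G a d b c y = 0 := by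
  simp only [riemann, riemannUp, ← Finset.sum_add_distrib, Finset.sum_sub_distrib]
  refine Finset.sum_eq_zero fun e _ => ?_
  have h := fun a b c => christoffel_symm (G := G) hG a b c
  rw [h e c b, h e d b, h e d c]
  simp only [h _ c b, h _ d b, h _ d c]
  ring

/-- Differentiating ∂_c G = Γ_cᵀ G + G Γ_c once more and using ∂_d∂_c G = ∂_c∂_d G, all terms
combine into the lowered curvature matrix plus its transpose, which is therefore zero. -/
theorem riemann_swap_left (hG : ∀ z, (G z).IsSymm)
    (hG2 : ∀ a b, ContDiffAt ℝ 2 (fun z => G z a b) y) (h : (G y).det ≠ 0) (a b c d : Fin m) :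
    riemann G a b c d y = -riemann G b a c d y := by
  have hd : DiffM G y := fun a b => (hG2 a b).differentiableAt (by norm_num)
  have hC := diffM_chrM hG2 h
  have hev := eventually_det_ne_zero (fun a b => (hG2 a b).continuousAt) h
  have h2 : ∀ c d, pdM d (pdM c G) y = (pdM d (chrM G c) y).transpose * G y +
      (chrM G c y).transpose * pdM d G y + (pdM d G y * chrM G c y + G y * pdM d (chrM G c) y) := by
    intro c d
    -- Parallelism is needed on a neighbourhood, since it is about to be differentiated.
    have hev' : ∀ᶠ z in 𝓝 y, pdM c G z = (chrM G c z).transpose * G z + G z * chrM G c z :=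
      hev.mono fun z hz => pdM_metric hG hz c
    rw [pdM_congr d hev', pdM_add d ((hC c).transpose.mul hd) (hd.mul (hC c)),
      pdM_mul d (hC c).transpose hd, pdM_mul d hd (hC c), pdM_transpose]
  have h3 : pdM d (pdM c G) y = pdM c (pdM d G) y := by
    ext a b
    exact pd_comm (hG2 a b) d c
  rw [h2, h2, pdM_metric hG h, pdM_metric hG h] at h3
  rw [riemann_eq hG, riemann_eq hG, ← Matrix.transpose_apply (G y * _) a b, Matrix.transpose_mul,
    (hG y).eq, ← Matrix.neg_apply]
  refine congrArg (fun M : Matrix (Fin m) (Fin m) ℝ => M a b) ?_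
  simp only [Matrix.transpose_add, Matrix.transpose_sub, Matrix.transpose_mul]
  rw [eq_neg_iff_add_eq_zero]
  rw [← sub_eq_zero] at h3
  rw [← neg_eq_zero, ← h3]
  noncomm_ring

end Christoffel

/-! ### Covariant derivatives of Newton tensors and their divergence. -/

section Divergence

variable {n : ℕ} {G H B : EuclideanSpace ℝ (Fin n) → Matrix (Fin n) (Fin n) ℝ}
  {ξ : EuclideanSpace ℝ (Fin n)}

/-- The covariant derivative `B^i_{k;j}` of a mixed tensor. -/
def covMixed (G B : EuclideanSpace ℝ (Fin n) → Matrix (Fin n) (Fin n) ℝ) (j : Fin n)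
    (ξ : EuclideanSpace ℝ (Fin n)) : Matrix (Fin n) (Fin n) ℝ :=
  pdM j B ξ + chrM G j ξ * B ξ - B ξ * chrM G j ξ

/-- The covariant derivative `h_{ik;j}` of a covariant tensor of order two. -/
def covLower (G H : EuclideanSpace ℝ (Fin n) → Matrix (Fin n) (Fin n) ℝ) (j : Fin n)
    (ξ : EuclideanSpace ℝ (Fin n)) : Matrix (Fin n) (Fin n) ℝ :=
  pdM j H ξ - (chrM G j ξ).transpose * H ξ - H ξ * chrM G j ξ

theorem pdM_inv_metric (hG : ∀ z, (G z).IsSymm) (hd : DiffM G ξ) (h : (G ξ).det ≠ 0) (j : Fin n) :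
    pdM j (fun z => (G z)⁻¹) ξ = -((G ξ)⁻¹ * (chrM G j ξ).transpose) - chrM G j ξ * (G ξ)⁻¹ := by
  rw [pdM_inv j hd h, pdM_metric hG h, mul_add, add_mul, ← mul_assoc (G ξ)⁻¹ (G ξ),
    Matrix.nonsing_inv_mul _ h.isUnit, one_mul, ← mul_assoc (G ξ)⁻¹, mul_assoc _ (G ξ),
    Matrix.mul_nonsing_inv _ h.isUnit, mul_one, neg_add, sub_eq_add_neg]

/-- Raising an index commutes with covariant differentiation because the inverse metric is parallel.
-/
theorem covMixed_inv_mul (hG : ∀ z, (G z).IsSymm) (hd : DiffM G ξ) (hh : DiffM H ξ)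
    (h : (G ξ).det ≠ 0) (j : Fin n) :
    covMixed G (fun z => (G z)⁻¹ * H z) j ξ = (G ξ)⁻¹ * covLower G H j ξ := by
  rw [covMixed, covLower, pdM_mul j (hd.inv h) hh, pdM_inv_metric hG hd h]
  noncomm_ring

/-- The product rule applied to N_{k+1} = N_k B + c_{k+1}·1, with Jacobi's formula for the
derivative of c_{k+1}. -/
theorem covMixed_newton_succ (hB : DiffM B ξ) (k : ℕ) (j : Fin n) :
    covMixed G (fun z => newton (k + 1) (B z)) j ξ =
      covMixed G (fun z => newton k (B z)) j ξ * B ξ + newton k (B ξ) * covMixed G B j ξ -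
        (newton k (B ξ) * covMixed G B j ξ).trace • 1 := by
  have hN : DiffM (fun z => newton k (B z)) ξ := differentiableAt_newton hB k
  obtain ⟨hc, hc'⟩ := fderiv_coeff_charpolyRev hB k
  have h1 : pdM j (fun z => newton (k + 1) (B z)) ξ =
      pdM j (fun z => newton k (B z)) ξ * B ξ + newton k (B ξ) * pdM j B ξ -
        (newton k (B ξ) * pdM j B ξ).trace • 1 := by
    simp only [newton_succ]
    have he : DiffM (fun z => (B z).charpolyRev.coeff (k + 1) • (1 : Matrix (Fin n) (Fin n) ℝ)) ξ :=
      fun a b => hc.mul (differentiableAt_const _)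
    rw [pdM_add j (hN.mul hB) he, pdM_mul j hN hB, sub_eq_add_neg, add_right_inj, ← neg_smul]
    ext a b
    have : pd j (fun z => (B z).charpolyRev.coeff (k + 1)) ξ = -(newton k (B ξ) * pdM j B ξ).trace :=
      hc' _
    simp only [pdM, Matrix.smul_apply, smul_eq_mul, Matrix.of_apply]
    rw [pd_mul j hc (differentiableAt_const _), pd_const, mul_zero, add_zero, this]
    rfl
  -- The connection contributes tr(N_k [Γ_j, B]), which vanishes as N_k commutes with B. So the
  -- partial derivative inside the trace may be replaced by the covariant one.
  have h2 : (newton k (B ξ) * covMixed G B j ξ).trace = (newton k (B ξ) * pdM j B ξ).trace := by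
    have : (newton k (B ξ) * (chrM G j ξ * B ξ)).trace =
        (newton k (B ξ) * (B ξ * chrM G j ξ)).trace := by
      rw [Matrix.trace_mul_comm, mul_assoc, ← newton_comm, ← mul_assoc, Matrix.trace_mul_comm,
        ← mul_assoc, Matrix.trace_mul_comm]
    rw [covMixed, mul_sub, mul_add, Matrix.trace_sub, Matrix.trace_add, this, add_sub_cancel_right]
  rw [h2, covMixed, h1, covMixed, covMixed, newton_succ]
  generalize (newton k (B ξ) * pdM j B ξ).trace = t
  generalize (B ξ).charpolyRev.coeff (k + 1) = s
  simp only [mul_add, add_mul, mul_sub, sub_mul, smul_mul_assoc, mul_smul_comm, mul_one, one_mul,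
    mul_assoc]
  abel

/-- The divergence of the Newton tensors vanishes recursively. -/
theorem sum_covMixed_newton_succ (hB : DiffM B ξ) (k : ℕ)
    (hk : ∀ i, ∑ j, covMixed G (fun z => newton k (B z)) j ξ j i = 0)
    (hc : ∀ i, ∑ j, (newton k (B ξ) * covMixed G B j ξ) j i =
      (newton k (B ξ) * covMixed G B i ξ).trace) (i : Fin n) :
    ∑ j, covMixed G (fun z => newton (k + 1) (B z)) j ξ j i = 0 := by
  simp only [covMixed_newton_succ hB, Matrix.sub_apply, Matrix.add_apply, Finset.sum_sub_distrib,
    Finset.sum_add_distrib, hc]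
  have h1 : ∑ j, (covMixed G (fun z => newton k (B z)) j ξ * B ξ) j i = 0 := by
    simp only [Matrix.mul_apply]
    rw [Finset.sum_comm]
    simp only [← Finset.sum_mul, hk, zero_mul, Finset.sum_const_zero]
  rw [h1]
  simp [Matrix.one_apply]

theorem sum_covMixed_newton_zero (i : Fin n) :
    ∑ j, covMixed G (fun z => newton 0 (B z)) j ξ j i = 0 := by
  refine Finset.sum_eq_zero fun j _ => ?_
  simp only [covMixed, newton_zero, mul_one, one_mul, add_sub_cancel_right]
  exact pd_const _ _

theorem sum_covMixed_newton (hB : DiffM B ξ)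
    (hc : ∀ i j l, covMixed G B j ξ l i = covMixed G B i ξ l j) (k : ℕ) (i : Fin n) :
    ∑ j, covMixed G (fun z => newton k (B z)) j ξ j i = 0 := by
  induction k generalizing i with
  | zero => exact sum_covMixed_newton_zero i
  | succ k ih =>
    refine sum_covMixed_newton_succ hB k ih (fun i => ?_) i
    simp only [Matrix.trace, Matrix.diag_apply, Matrix.mul_apply, hc i]

theorem divergenceFreeAt_newton (hG : ∀ z, (G z).IsSymm) (hd : DiffM G ξ) (hh : DiffM H ξ)
    (h : (G ξ).det ≠ 0) (hs : ∀ᶠ z in 𝓝 ξ, (H z).IsSymm) (k : ℕ) (c : ℝ)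
    (hk : ∀ i, ∑ j, covMixed G (fun z => newton k ((G z)⁻¹ * H z)) j ξ j i = 0)
    {T : EuclideanSpace ℝ (Fin n) → Matrix (Fin n) (Fin n) ℝ}
    (hT : ∀ᶠ z in 𝓝 ξ, T z = c • (newton k ((G z)⁻¹ * H z) * (G z)⁻¹)) :
    DivergenceFreeAt G T ξ := by
  set S := fun z => newton k ((G z)⁻¹ * H z) with hS
  have hB : DiffM (fun z => (G z)⁻¹ * H z) ξ := (hd.inv h).mul hh
  have hSd : DiffM S ξ := differentiableAt_newton hB k
  have hU : DiffM (fun z => S z * (G z)⁻¹) ξ := hSd.mul (hd.inv h)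
  have hTe : ∀ i j, (fun z => T z i j) =ᶠ[𝓝 ξ] fun z => c * (S z * (G z)⁻¹) i j := fun i j =>
    hT.mono fun z hz => congrFun (congrFun hz i) j
  refine ⟨fun i j => ((hU i j).const_mul c).congr_of_eventuallyEq (hTe i j), fun i => ?_⟩
  have h1 : ∀ j, pdM j (fun z => S z * (G z)⁻¹) ξ + chrM G j ξ * (S ξ * (G ξ)⁻¹) +
      S ξ * (G ξ)⁻¹ * (chrM G j ξ).transpose = covMixed G S j ξ * (G ξ)⁻¹ := by
    intro j
    rw [pdM_mul j hSd (hd.inv h), pdM_inv_metric hG hd h, covMixed]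
    noncomm_ring
  have hsym : ∀ᶠ z in 𝓝 ξ, (S z * (G z)⁻¹).transpose = S z * (G z)⁻¹ :=
    hs.mono fun z hz => newton_mul_inv_transpose hz (hG z) k
  -- The hypothesis `hk` contracts j with the upper index of S, whereas the divergence of T
  -- contracts j with the index raised by g⁻¹. Symmetry of the covariant derivative of S g⁻¹
  -- exchanges the two.
  have h2 : ∀ j, (covMixed G S j ξ * (G ξ)⁻¹).transpose = covMixed G S j ξ * (G ξ)⁻¹ := by
    intro j
    have e1 := pdM_congr j hsym
    rw [pdM_transpose] at e1
    have e2 : ((G ξ)⁻¹).transpose = (G ξ)⁻¹ := by rw [Matrix.transpose_nonsing_inv, (hG ξ).eq]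
    rw [← h1, Matrix.transpose_add, Matrix.transpose_add, e1, Matrix.transpose_mul,
      Matrix.transpose_mul _ (chrM G j ξ).transpose, Matrix.transpose_transpose, hsym.self_of_nhds]
    abel
  have h3 : ∀ j, pd j (fun z => T z i j) ξ + ∑ k, christoffel G i j k ξ * T ξ k j +
      ∑ k, christoffel G j j k ξ * T ξ i k = c * (covMixed G S j ξ * (G ξ)⁻¹) j i := by
    intro j
    have hj : (covMixed G S j ξ * (G ξ)⁻¹) j i = (covMixed G S j ξ * (G ξ)⁻¹) i j :=
      congrFun (congrFun (h2 j) i) j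
    rw [hj, ← h1, pd_congr j (hTe i j), hT.self_of_nhds, pd_mul j (differentiableAt_const _) (hU i j),
      pd_const, zero_mul, zero_add, Matrix.add_apply, Matrix.add_apply, mul_add, mul_add,
      Matrix.mul_apply (M := chrM G j ξ), Matrix.mul_apply (M := S ξ * (G ξ)⁻¹) (i := i) (k := j),
      Finset.mul_sum, Finset.mul_sum]
    congr 1
    · congr 1
      exact Finset.sum_congr rfl fun l _ => mul_left_comm _ _ _
    · refine Finset.sum_congr rfl fun l _ => ?_
      rw [Matrix.smul_apply, smul_eq_mul, mul_left_comm, mul_comm (christoffel G j j l ξ)]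
      rfl
  simp only [h3, ← Finset.mul_sum, Matrix.mul_apply]
  rw [Finset.sum_comm]
  simp only [← Finset.sum_mul]
  simp only [hk, zero_mul, Finset.sum_const_zero, mul_zero]

end Divergence

/-! ### The curvature form, constant sectional curvature and the Ricci contraction. -/

section CurvatureForm

variable {m : ℕ} {G : EuclideanSpace ℝ (Fin m) → Matrix (Fin m) (Fin m) ℝ}
  {y : EuclideanSpace ℝ (Fin m)}

/-- The curvature tensor as a quadrilinear form. -/
def riemannForm (G : EuclideanSpace ℝ (Fin m) → Matrix (Fin m) (Fin m) ℝ)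
    (y : EuclideanSpace ℝ (Fin m)) (v w z u : Fin m → ℝ) : ℝ :=
  ∑ a, ∑ b, ∑ c, ∑ d, riemann G a b c d y * v a * w b * z c * u d

theorem riemannForm_add_left (v v' w z u : Fin m → ℝ) :
    riemannForm G y (v + v') w z u = riemannForm G y v w z u + riemannForm G y v' w z u := by
  simp only [riemannForm, ← Finset.sum_add_distrib, Pi.add_apply]
  refine Finset.sum_congr rfl fun a _ => Finset.sum_congr rfl fun b _ =>
    Finset.sum_congr rfl fun c _ => Finset.sum_congr rfl fun d _ => ?_
  ring

theorem riemannForm_swap_right (v w z u : Fin m → ℝ) :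
    riemannForm G y v w z u = -riemannForm G y v w u z := by
  simp only [riemannForm, ← Finset.sum_neg_distrib]
  refine Finset.sum_congr rfl fun a _ => Finset.sum_congr rfl fun b _ => ?_
  rw [Finset.sum_comm]
  refine Finset.sum_congr rfl fun c _ => Finset.sum_congr rfl fun d _ => ?_
  rw [riemann_swap_right]
  ring

theorem riemannForm_swap_left (hG : ∀ z, (G z).IsSymm)
    (hG2 : ∀ a b, ContDiffAt ℝ 2 (fun z => G z a b) y) (h : (G y).det ≠ 0) (v w z u : Fin m → ℝ) :
    riemannForm G y v w z u = -riemannForm G y w v z u := by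
  simp only [riemannForm, ← Finset.sum_neg_distrib]
  rw [Finset.sum_comm]
  refine Finset.sum_congr rfl fun a _ => Finset.sum_congr rfl fun b _ =>
    Finset.sum_congr rfl fun c _ => Finset.sum_congr rfl fun d _ => ?_
  rw [riemann_swap_left hG hG2 h]
  ring

theorem riemannForm_cyclic (hG : ∀ z, (G z).IsSymm) (v w z u : Fin m → ℝ) :
    riemannForm G y v w z u + riemannForm G y v z u w + riemannForm G y v u w z = 0 := by
  have h1 : riemannForm G y v z u w =
      ∑ a, ∑ b, ∑ c, ∑ d, riemann G a c d b y * v a * w b * z c * u d := by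
    refine Finset.sum_congr rfl fun a _ => ?_
    have : ∀ c, ∑ d, ∑ b, riemann G a c d b y * v a * z c * u d * w b =
        ∑ b, ∑ d, riemann G a c d b y * v a * w b * z c * u d := fun c => by
      rw [Finset.sum_comm]
      exact Finset.sum_congr rfl fun b _ => Finset.sum_congr rfl fun d _ => by ring
    simp only [this]
    exact Finset.sum_comm
  have h2 : riemannForm G y v u w z =
      ∑ a, ∑ b, ∑ c, ∑ d, riemann G a d b c y * v a * w b * z c * u d := by
    refine Finset.sum_congr rfl fun a _ => ?_
    rw [Finset.sum_comm]
    refine Finset.sum_congr rfl fun b _ => ?_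
    rw [Finset.sum_comm]
    exact Finset.sum_congr rfl fun b _ => Finset.sum_congr rfl fun d _ => by ring
  rw [h1, h2]
  simp only [riemannForm, ← Finset.sum_add_distrib]
  refine Finset.sum_eq_zero fun a _ => Finset.sum_eq_zero fun b _ =>
    Finset.sum_eq_zero fun c _ => Finset.sum_eq_zero fun d _ => ?_
  have := riemann_cyclic (y := y) hG a b c d
  linear_combination v a * w b * z c * u d * this

/-- A tensor with the symmetries of the curvature tensor and vanishing sectional curvature is
zero. -/
theorem eq_zero_of_curvature_symmetries {V : Type*} [AddCommGroup V] (D : V → V → V → V → ℝ)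
    (hadd : ∀ v v' w z u, D (v + v') w z u = D v w z u + D v' w z u)
    (hr : ∀ v w z u, D v w z u = -D v w u z) (hl : ∀ v w z u, D v w z u = -D w v z u)
    (hc : ∀ v w z u, D v w z u + D v z u w + D v u w z = 0) (h : ∀ v w, D v w v w = 0)
    (v w z u : V) : D v w z u = 0 := by
  -- Pair symmetry, a combination of four Bianchi identities and the two skew symmetries.
  have hp : ∀ v w z u, D v w z u = D z u v w := fun v w z u => by
    linarith [hc v w z u, hc w z u v, hc z u v w, hc u v w z, hl v w z u, hl v z u w, hl v u w z,
      hl w z u v, hl w u v z, hl z u v w, hr v w z u, hr v z u w, hr v u w z,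
      hr w z u v, hr w u v z, hr z u v w, hr w v z u, hr z v u w, hr u v w z, hr z w u v, hr u w v z,
      hr u z v w]
  -- Polarization in the first and third slots; pair symmetry makes the two cross terms equal.
  have h1 : ∀ v w z, D v w z w = 0 := fun v w z => by
    have := h (v + z) w
    rw [hadd, hp v w, hp z w, hadd, hadd, h, h] at this
    linarith [hp v w z w]
  -- Polarization in the second and fourth slots. With skew symmetry in the last pair this makes D
  -- invariant under cyclic permutation of its last three arguments, so the Bianchi identity reads
  -- 3D = 0.
  have h2 : ∀ v w z u, D v w z u = -D v u z w := fun v w z u => by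
    have := h1 v (w + u) z
    rw [hl v, hadd, hl w v, hl u v, hp v w, hp v u, hr z, hl z (w + u), hr z, hl z (w + u), hadd,
      hadd, hl w z, hl u z, hl w z, hl u z, hp z w, hp z u, hp z w, hp z u] at this
    linarith [h1 v w z, h1 v u z, hl w v z w, hl u v z u, hl w v z u, hl u v z w]
  linarith [h2 v w z u, h2 v z u w, h2 v u w z, hr v w z u, hr v z u w, hr v u w z, hc v w z u]

theorem planeForm_eq (A : Matrix (Fin m) (Fin m) ℝ) (hA : A.IsSymm) (v w : Fin m → ℝ) :
    planeForm A v w = (v ⬝ᵥ A.mulVec v) * (w ⬝ᵥ A.mulVec w) - (v ⬝ᵥ A.mulVec w) * (w ⬝ᵥ A.mulVec v) := by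
  have : w ⬝ᵥ A.mulVec v = v ⬝ᵥ A.mulVec w := by
    rw [Matrix.dotProduct_mulVec, ← Matrix.mulVec_transpose, hA.eq, dotProduct_comm]
  rw [planeForm, this, sq]

theorem continuous_riemannForm {f g h k : ℝ → Fin m → ℝ} (hf : Continuous f) (hg : Continuous g)
    (hh : Continuous h) (hk : Continuous k) :
    Continuous fun t => riemannForm G y (f t) (g t) (h t) (k t) := by
  unfold riemannForm
  fun_prop

/-- Planes near a nondegenerate one are generic, so the curvature tensor is determined by the
sectional curvatures of nondegenerate planes. -/
theorem riemannForm_of_sectionalCurvature (hG : ∀ z, (G z).IsSymm)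
    (hG2 : ∀ a b, ContDiffAt ℝ 2 (fun z => G z a b) y) (h : (G y).det ≠ 0) {K : ℝ}
    (hK : ∀ v w, planeForm (G y) v w ≠ 0 → sectionalCurvature G y v w = K)
    {v₀ w₀ : Fin m → ℝ} (h₀ : planeForm (G y) v₀ w₀ ≠ 0) (v w z u : Fin m → ℝ) :
    riemannForm G y v w z u = K * ((v ⬝ᵥ (G y).mulVec z) * (w ⬝ᵥ (G y).mulVec u) -
      (v ⬝ᵥ (G y).mulVec u) * (w ⬝ᵥ (G y).mulVec z)) := by
  have hs : ∀ v w, w ⬝ᵥ (G y).mulVec v = v ⬝ᵥ (G y).mulVec w := fun v w => by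
    rw [Matrix.dotProduct_mulVec, ← Matrix.mulVec_transpose, (hG y).eq, dotProduct_comm]
  refine sub_eq_zero.1 (eq_zero_of_curvature_symmetries (fun v w z u => riemannForm G y v w z u -
    K * ((v ⬝ᵥ (G y).mulVec z) * (w ⬝ᵥ (G y).mulVec u) -
      (v ⬝ᵥ (G y).mulVec u) * (w ⬝ᵥ (G y).mulVec z))) ?_ ?_ ?_ ?_ ?_ v w z u)
  · intro v v' w z u
    simp only [riemannForm_add_left, add_dotProduct]
    ring
  · intro v w z u
    rw [riemannForm_swap_right]
    ring
  · intro v w z u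
    rw [riemannForm_swap_left hG hG2 h]
    ring
  · intro v w z u
    rw [hs z u, hs w u, hs w z]
    linear_combination riemannForm_cyclic (y := y) hG v w z u
  · intro v w
    rw [← planeForm_eq _ (hG y)]
    -- The path starts at the given pair (v, w) and reaches the nondegenerate pair (v₀, w₀) at t =
    -- 1. Along it `planeForm` is a polynomial in t that is nonzero at t = 1, so the planes are
    -- nondegenerate off a finite set, and continuity carries the identity to t = 0.
    set V : ℝ → Fin m → ℝ := fun t => v + t • (v₀ - v) with hV
    set W : ℝ → Fin m → ℝ := fun t => w + t • (w₀ - w) with hW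
    have hVc : Continuous V := by fun_prop
    have hWc : Continuous W := by fun_prop
    have hcont : Continuous fun t => riemannForm G y (V t) (W t) (V t) (W t) -
        K * planeForm (G y) (V t) (W t) := by
      refine (continuous_riemannForm hVc hWc hVc hWc).sub (continuous_const.mul ?_)
      unfold planeForm
      fun_prop
    obtain ⟨P, hP⟩ : ∃ P : Polynomial ℝ, ∀ t, P.eval t = planeForm (G y) (V t) (W t) := by
      open Polynomial in
      refine ⟨(C (v ⬝ᵥ (G y).mulVec v) + X * C (v ⬝ᵥ (G y).mulVec (v₀ - v)) +
          X * (C ((v₀ - v) ⬝ᵥ (G y).mulVec v) + X * C ((v₀ - v) ⬝ᵥ (G y).mulVec (v₀ - v)))) *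
        (C (w ⬝ᵥ (G y).mulVec w) + X * C (w ⬝ᵥ (G y).mulVec (w₀ - w)) +
          X * (C ((w₀ - w) ⬝ᵥ (G y).mulVec w) + X * C ((w₀ - w) ⬝ᵥ (G y).mulVec (w₀ - w)))) -
        (C (v ⬝ᵥ (G y).mulVec w) + X * C (v ⬝ᵥ (G y).mulVec (w₀ - w)) +
          X * (C ((v₀ - v) ⬝ᵥ (G y).mulVec w) + X * C ((v₀ - v) ⬝ᵥ (G y).mulVec (w₀ - w)))) ^ 2,
        fun t => ?_⟩
      simp only [planeForm, hV, hW, Matrix.mulVec_add, Matrix.mulVec_smul, add_dotProduct,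
        dotProduct_add, smul_dotProduct, dotProduct_smul, smul_eq_mul, eval_sub, eval_mul, eval_add,
        eval_pow, eval_C, eval_X]
      ring
    have hP0 : P ≠ 0 := by
      rintro rfl
      have := hP 1
      simp only [hV, hW, one_smul, add_sub_cancel, Polynomial.eval_zero] at this
      exact h₀ this.symm
    have hzero : ∀ t, P.eval t ≠ 0 → riemannForm G y (V t) (W t) (V t) (W t) -
        K * planeForm (G y) (V t) (W t) = 0 := by
      intro t ht
      rw [hP] at ht
      have := hK _ _ ht
      rw [sectionalCurvature, div_eq_iff ht] at this
      exact sub_eq_zero.2 this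
    have hdense : Dense {t : ℝ | P.eval t ≠ 0} := by
      have hfin : {t : ℝ | P.eval t = 0}.Finite := by
        refine (P.roots.toFinset.finite_toSet).subset fun t ht => ?_
        simpa [hP0] using ht
      exact hfin.countable.dense_compl ℝ
    have := congrFun (Continuous.ext_on hdense hcont continuous_const fun t ht => hzero t ht) 0
    simpa [hV, hW] using this

/-- The contraction of the curvature tensor in its second and third slots. -/
theorem sum_inv_mul_riemann (hG : ∀ z, (G z).IsSymm)
    (hG2 : ∀ a b, ContDiffAt ℝ 2 (fun z => G z a b) y) (h : (G y).det ≠ 0) (a d : Fin m) :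
    ∑ b, ∑ c, (G y)⁻¹ c b * riemann G a b c d y = -ricci G a d y := by
  rw [Finset.sum_comm, ricci, ← Finset.sum_neg_distrib]
  refine Finset.sum_congr rfl fun c _ => ?_
  have h1 := congrFun (congrArg (fun M : Matrix (Fin m) (Fin m) ℝ => M.mulVec
    fun e => riemannUp G e a c d y) (Matrix.nonsing_inv_mul _ h.isUnit)) c
  rw [← Matrix.mulVec_mulVec, Matrix.one_mulVec] at h1
  rw [← h1, Matrix.mulVec, dotProduct, ← Finset.sum_neg_distrib]
  refine Finset.sum_congr rfl fun b _ => ?_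
  rw [riemann_swap_left hG hG2 h, mul_neg]
  rfl

end CurvatureForm

open scoped Matrix

/-! ### Decomposition into tangential and normal parts. -/

section Frame

variable {n : ℕ} {A : Matrix (Fin (n + 1)) (Fin (n + 1)) ℝ} {J : Matrix (Fin (n + 1)) (Fin n) ℝ}
  {v : Fin (n + 1) → ℝ} {σ : ℝ}

/-- The tangent vectors, the columns of `J`, and the unit normal `v` form a basis. -/
theorem frame_complete (hg : (Jᵀ * A * J).det ≠ 0) (hA : A.IsSymm)
    (hv : ∀ i, v ⬝ᵥ A *ᵥ J.col i = 0) (hσ : v ⬝ᵥ A *ᵥ v = σ) (hσ2 : σ * σ = 1) :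
    J * (Jᵀ * A * J)⁻¹ * Jᵀ * A + σ • (Matrix.vecMulVec v v * A) = 1 := by
  set V : Matrix (Fin (n + 1)) Unit ℝ := Matrix.replicateCol Unit v with hV
  have h1 : Vᵀ * A * J = 0 := by
    ext a i
    have h := hv i
    rw [Matrix.mul_assoc, Matrix.mul_apply]
    simp only [Matrix.mul_apply, dotProduct, Matrix.mulVec, Matrix.col_apply] at h ⊢
    exact h
  have h2 : Jᵀ * A * V = 0 := by
    rw [← Matrix.transpose_inj, Matrix.transpose_mul, Matrix.transpose_mul, hA.eq,
      Matrix.transpose_transpose, ← Matrix.mul_assoc, h1, Matrix.transpose_zero]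
  have h3 : Vᵀ * A * V = σ • 1 := by
    ext a b
    rw [Matrix.mul_assoc, Matrix.mul_apply]
    simp only [Matrix.mul_apply, dotProduct, Matrix.mulVec] at hσ ⊢
    simpa [hV] using hσ
  -- Orthogonality gives a left inverse of the frame matrix (J | v). Since n + 1 columns make it
  -- square, this is also a right inverse, and that is the completeness relation.
  have hL : Matrix.fromRows ((Jᵀ * A * J)⁻¹ * (Jᵀ * A)) (σ • (Vᵀ * A)) * Matrix.fromCols J V = 1 := by
    rw [Matrix.fromRows_mul_fromCols, Matrix.mul_assoc, Matrix.nonsing_inv_mul _ hg.isUnit,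
      Matrix.mul_assoc _ _ V, h2, Matrix.smul_mul, h1, Matrix.smul_mul, h3, Matrix.mul_zero,
      smul_zero, smul_smul, hσ2, one_smul, Matrix.fromBlocks_one]
  have e : Fin n ⊕ Unit ≃ Fin (n + 1) := Fintype.equivOfCardEq (by simp)
  have hR := (Matrix.mul_eq_one_comm_of_equiv e).1 hL
  rw [Matrix.fromCols_mul_fromRows] at hR
  rw [← hR, Matrix.vecMulVec_eq Unit, Matrix.mul_smul]
  simp only [Matrix.mul_assoc, hV, Matrix.transpose_replicateCol]

theorem frame_decomp (hg : (Jᵀ * A * J).det ≠ 0) (hA : A.IsSymm)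
    (hv : ∀ i, v ⬝ᵥ A *ᵥ J.col i = 0) (hσ : v ⬝ᵥ A *ᵥ v = σ) (hσ2 : σ * σ = 1)
    (w : Fin (n + 1) → ℝ) :
    w = (J * (Jᵀ * A * J)⁻¹ * Jᵀ * A) *ᵥ w + (σ * (v ⬝ᵥ A *ᵥ w)) • v := by
  have h := congrArg (fun M : Matrix (Fin (n + 1)) (Fin (n + 1)) ℝ => M *ᵥ w)
    (frame_complete hg hA hv hσ hσ2)
  simp only [Matrix.one_mulVec, Matrix.add_mulVec, Matrix.smul_mulVec] at h
  rw [← Matrix.mulVec_mulVec w (Matrix.vecMulVec v v) A, Matrix.vecMulVec_mulVec] at h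
  rw [mul_smul]
  simpa using h.symm

end Frame

/-! ### The pulled back connection along a parametrized submanifold. -/

section Local

variable {m n : ℕ}

/-- The coordinate tangent vectors, as the columns of a matrix. -/
def tangentM (X : EuclideanSpace ℝ (Fin n) → EuclideanSpace ℝ (Fin m))
    (ξ : EuclideanSpace ℝ (Fin n)) : Matrix (Fin m) (Fin n) ℝ :=
  Matrix.of fun a i => pd i (fun ζ => X ζ a) ξ

/-- The induced metric of a parametrized submanifold. -/
def indMetric (G : EuclideanSpace ℝ (Fin m) → Matrix (Fin m) (Fin m) ℝ)
    (X : EuclideanSpace ℝ (Fin n) → EuclideanSpace ℝ (Fin m)) (ξ : EuclideanSpace ℝ (Fin n)) :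
    Matrix (Fin n) (Fin n) ℝ :=
  Matrix.of fun i j => ∑ a, ∑ b, G (X ξ) a b * tangentM X ξ a i * tangentM X ξ b j

/-- The second fundamental form of a parametrized hypersurface with normal `ν`. -/
def secondForm (G : EuclideanSpace ℝ (Fin m) → Matrix (Fin m) (Fin m) ℝ)
    (X : EuclideanSpace ℝ (Fin n) → EuclideanSpace ℝ (Fin m))
    (ν : EuclideanSpace ℝ (Fin n) → Fin m → ℝ) (ξ : EuclideanSpace ℝ (Fin n)) :
    Matrix (Fin n) (Fin n) ℝ :=
  Matrix.of fun i j => -∑ a, ∑ b, G (X ξ) a b *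
    (pd i (fun ζ => tangentM X ζ a j) ξ
      - ∑ k, christoffel (indMetric G X) k i j ξ * tangentM X ξ a k
      + ∑ b, ∑ c, christoffel G a b c (X ξ) * tangentM X ξ b i * tangentM X ξ c j) * ν ξ b

/-- The matrix of the pulled back Levi-Civita connection in the direction `∂/∂ξⁱ`. -/
def pullConn (G : EuclideanSpace ℝ (Fin m) → Matrix (Fin m) (Fin m) ℝ)
    (X : EuclideanSpace ℝ (Fin n) → EuclideanSpace ℝ (Fin m)) (i : Fin n)
    (ξ : EuclideanSpace ℝ (Fin n)) : Matrix (Fin m) (Fin m) ℝ :=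
  ∑ b, tangentM X ξ b i • chrM G b (X ξ)

/-- The covariant derivative of a vector field along `X`. -/
def covAlong (G : EuclideanSpace ℝ (Fin m) → Matrix (Fin m) (Fin m) ℝ)
    (X : EuclideanSpace ℝ (Fin n) → EuclideanSpace ℝ (Fin m)) (i : Fin n)
    (V : EuclideanSpace ℝ (Fin n) → Fin m → ℝ) (ξ : EuclideanSpace ℝ (Fin n)) : Fin m → ℝ :=
  pdV i V ξ + pullConn G X i ξ *ᵥ V ξ

variable {G : EuclideanSpace ℝ (Fin m) → Matrix (Fin m) (Fin m) ℝ}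
  {X : EuclideanSpace ℝ (Fin n) → EuclideanSpace ℝ (Fin m)} {ξ : EuclideanSpace ℝ (Fin n)}

theorem indMetric_eq : indMetric G X ξ = (tangentM X ξ)ᵀ * G (X ξ) * tangentM X ξ := by
  ext i j
  simp only [indMetric, Matrix.of_apply, Matrix.mul_apply, Matrix.transpose_apply, Finset.sum_mul]
  rw [Finset.sum_comm]
  exact Finset.sum_congr rfl fun a _ => Finset.sum_congr rfl fun b _ => by ring

theorem indMetric_apply (i j : Fin n) : indMetric G X ξ i j =
    (tangentM X ξ).col i ⬝ᵥ G (X ξ) *ᵥ (tangentM X ξ).col j := by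
  simp only [indMetric, Matrix.of_apply, dotProduct, Matrix.mulVec, Matrix.col_apply,
    Finset.mul_sum]
  exact Finset.sum_congr rfl fun a _ => Finset.sum_congr rfl fun b _ => by ring

theorem indMetric_isSymm (hG : ∀ z, (G z).IsSymm) : (indMetric G X ξ).IsSymm := by
  rw [indMetric_eq, Matrix.IsSymm]
  simp only [Matrix.transpose_mul, Matrix.transpose_transpose, (hG _).eq, Matrix.mul_assoc]

theorem bilin_comm {A : Matrix (Fin m) (Fin m) ℝ} (hA : A.IsSymm) (v w : Fin m → ℝ) :
    v ⬝ᵥ A *ᵥ w = w ⬝ᵥ A *ᵥ v := by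
  rw [Matrix.dotProduct_mulVec, ← Matrix.mulVec_transpose, hA.eq, dotProduct_comm]

theorem contDiffAt_tangentM {k l : ℕ∞ω} (hX : ContDiffAt ℝ k X ξ) (hkl : l + 1 ≤ k) (a : Fin m)
    (i : Fin n) : ContDiffAt ℝ l (fun ζ => tangentM X ζ a i) ξ :=
  contDiffAt_pd (f := fun ζ => X ζ a) ((contDiffAt_piLp 2).1 hX a) hkl i

theorem contDiffAt_pullConn (hG2 : ∀ a b, ContDiffAt ℝ 2 (fun z => G z a b) (X ξ))
    (h : (G (X ξ)).det ≠ 0) (hX : ContDiffAt ℝ 2 X ξ) (i : Fin n) (a c : Fin m) :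
    ContDiffAt ℝ 1 (fun ζ => pullConn G X i ζ a c) ξ := by
  simp only [pullConn, Matrix.sum_apply, Matrix.smul_apply, smul_eq_mul]
  exact ContDiffAt.sum fun b _ => (contDiffAt_tangentM hX (by norm_num) b i).mul
    ((contDiffAt_christoffel hG2 h a b c).comp ξ (hX.of_le (by norm_num)))

theorem pdM_comp_metric (hG : ∀ z, (G z).IsSymm) (hd : DiffM G (X ξ)) (h : (G (X ξ)).det ≠ 0)
    (hX : DifferentiableAt ℝ X ξ) (i : Fin n) :
    pdM i (fun ζ => G (X ζ)) ξ = (pullConn G X i ξ)ᵀ * G (X ξ) + G (X ξ) * pullConn G X i ξ := by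
  have h1 : pdM i (fun ζ => G (X ζ)) ξ = ∑ b, tangentM X ξ b i • pdM b G (X ξ) := by
    ext a c
    simp only [Matrix.sum_apply, Matrix.smul_apply, smul_eq_mul]
    exact pd_comp (f := fun z => G z a c) i (hd a c) hX
  simp only [h1, pdM_metric hG h, pullConn, Matrix.transpose_sum, Matrix.transpose_smul,
    Finset.sum_mul, Finset.mul_sum, Matrix.smul_mul, Matrix.mul_smul, smul_add,
    Finset.sum_add_distrib]

/-- The pulled back connection is metric. -/
theorem pd_bilin (hG : ∀ z, (G z).IsSymm) (hd : DiffM G (X ξ)) (h : (G (X ξ)).det ≠ 0)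
    (hX : DifferentiableAt ℝ X ξ) (i : Fin n) {V W : EuclideanSpace ℝ (Fin n) → Fin m → ℝ}
    (hV : DiffV V ξ) (hW : DiffV W ξ) :
    pd i (fun ζ => V ζ ⬝ᵥ G (X ζ) *ᵥ W ζ) ξ =
      covAlong G X i V ξ ⬝ᵥ G (X ξ) *ᵥ W ξ + V ξ ⬝ᵥ G (X ξ) *ᵥ covAlong G X i W ξ := by
  have hGX : DiffM (fun ζ => G (X ζ)) ξ := fun a b => (hd a b).comp ξ hX
  rw [pd_dotProduct i hV (hGX.mulVec hW), pdV_mulVec i hGX hW, pdM_comp_metric hG hd h hX,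
    covAlong, covAlong]
  have h2 : V ξ ⬝ᵥ ((pullConn G X i ξ)ᵀ * G (X ξ)) *ᵥ W ξ =
      (pullConn G X i ξ *ᵥ V ξ) ⬝ᵥ G (X ξ) *ᵥ W ξ := by
    rw [← Matrix.mulVec_mulVec, Matrix.dotProduct_mulVec, Matrix.vecMul_transpose]
  simp only [Matrix.add_mulVec, Matrix.mulVec_add, dotProduct_add, add_dotProduct, h2,
    Matrix.mulVec_mulVec]
  ring

theorem pullConn_mulVec_col (i j : Fin n) (a : Fin m) :
    (pullConn G X i ξ *ᵥ (tangentM X ξ).col j) a =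
      ∑ b, ∑ c, christoffel G a b c (X ξ) * tangentM X ξ b i * tangentM X ξ c j := by
  simp only [pullConn, Matrix.mulVec, dotProduct, Matrix.sum_apply, Matrix.smul_apply,
    Matrix.col_apply, chrM, Matrix.of_apply, smul_eq_mul, Finset.sum_mul]
  rw [Finset.sum_comm]
  exact Finset.sum_congr rfl fun b _ => Finset.sum_congr rfl fun c _ => by ring

/-- The pulled back connection is torsion free. -/
theorem covAlong_tangent_comm (hG : ∀ z, (G z).IsSymm) (hX : ContDiffAt ℝ 2 X ξ) (i j : Fin n) :
    covAlong G X i (fun ζ => (tangentM X ζ).col j) ξ =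
      covAlong G X j (fun ζ => (tangentM X ζ).col i) ξ := by
  ext a
  simp only [covAlong, Pi.add_apply, pullConn_mulVec_col]
  congr 1
  · exact pd_comm (f := fun ζ => X ζ a) ((contDiffAt_piLp 2).1 hX a) i j
  · rw [Finset.sum_comm]
    refine Finset.sum_congr rfl fun b _ => Finset.sum_congr rfl fun c _ => ?_
    rw [christoffel_symm hG]
    ring

theorem diffV_tangent (hX : ContDiffAt ℝ 2 X ξ) (j : Fin n) :
    DiffV (fun ζ => (tangentM X ζ).col j) ξ := fun a =>
  (contDiffAt_tangentM (l := 1) hX (by norm_num) a j).differentiableAt (by norm_num)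

theorem pd_indMetric (hG : ∀ z, (G z).IsSymm) (hd : DiffM G (X ξ)) (h : (G (X ξ)).det ≠ 0)
    (hX : ContDiffAt ℝ 2 X ξ) (i j k : Fin n) :
    pd i (fun ζ => indMetric G X ζ j k) ξ =
      covAlong G X i (fun ζ => (tangentM X ζ).col j) ξ ⬝ᵥ G (X ξ) *ᵥ (tangentM X ξ).col k +
      covAlong G X i (fun ζ => (tangentM X ζ).col k) ξ ⬝ᵥ G (X ξ) *ᵥ (tangentM X ξ).col j := by
  simp only [indMetric_apply]
  rw [pd_bilin hG hd h (hX.differentiableAt (by norm_num)) i (diffV_tangent hX j)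
    (diffV_tangent hX k), bilin_comm (hG _) ((tangentM X ξ).col j)]

/-- The Christoffel symbols of the induced metric are the tangential part of the pulled back
connection. -/
theorem sum_indMetric_mul_christoffel (hG : ∀ z, (G z).IsSymm) (hd : DiffM G (X ξ))
    (h : (G (X ξ)).det ≠ 0) (hX : ContDiffAt ℝ 2 X ξ) (hg : (indMetric G X ξ).det ≠ 0)
    (i j k : Fin n) :
    ∑ l, indMetric G X ξ k l * christoffel (indMetric G X) l i j ξ =
      (tangentM X ξ).col k ⬝ᵥ G (X ξ) *ᵥ covAlong G X i (fun ζ => (tangentM X ζ).col j) ξ := by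
  -- Koszul's formula: each derivative of the induced metric splits by the product rule, and
  -- torsion-freeness cancels all but twice the wanted term.
  rw [sum_mul_christoffel hg, pd_indMetric hG hd h hX, pd_indMetric hG hd h hX,
    pd_indMetric hG hd h hX, covAlong_tangent_comm hG hX j i, covAlong_tangent_comm hG hX k i,
    covAlong_tangent_comm hG hX k j, bilin_comm (hG _)]
  ring

/-- The commutator of covariant derivatives along `X` is the curvature. -/
theorem covAlong_comm (hG : ∀ z, (G z).IsSymm)
    (hG2 : ∀ a b, ContDiffAt ℝ 2 (fun z => G z a b) (X ξ)) (h : (G (X ξ)).det ≠ 0)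
    (hX : ContDiffAt ℝ 2 X ξ) {V : EuclideanSpace ℝ (Fin n) → Fin m → ℝ}
    (hV : ∀ a, ContDiffAt ℝ 2 (fun ζ => V ζ a) ξ) (k i : Fin n) (w : Fin m → ℝ) :
    w ⬝ᵥ G (X ξ) *ᵥ (covAlong G X k (covAlong G X i V) ξ - covAlong G X i (covAlong G X k V) ξ) =
      riemannForm G (X ξ) w (V ξ) ((tangentM X ξ).col k) ((tangentM X ξ).col i) := by
  have hO : ∀ i, DiffM (pullConn G X i) ξ := fun i a b =>
    (contDiffAt_pullConn hG2 h hX i a b).differentiableAt (by norm_num)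
  have hVd : DiffV V ξ := fun a => (hV a).differentiableAt (by norm_num)
  have hpV : ∀ i, DiffV (pdV i V) ξ := fun i a =>
    (contDiffAt_pd (l := 1) (hV a) (by norm_num) i).differentiableAt (by norm_num)
  have h1 : ∀ k i, covAlong G X k (covAlong G X i V) ξ = pdV k (pdV i V) ξ +
      (pdM k (pullConn G X i) ξ *ᵥ V ξ + pullConn G X i ξ *ᵥ pdV k V ξ) +
      (pullConn G X k ξ *ᵥ pdV i V ξ + (pullConn G X k ξ * pullConn G X i ξ) *ᵥ V ξ) := by
    intro k i
    have : pdV k (covAlong G X i V) ξ = pdV k (fun ζ => pdV i V ζ + pullConn G X i ζ *ᵥ V ζ) ξ := rfl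
    rw [covAlong, this, pdV_add k (hpV i) ((hO i).mulVec hVd), pdV_mulVec k (hO i) hVd, covAlong,
      Matrix.mulVec_add, Matrix.mulVec_mulVec]
  have hsym : pdV k (pdV i V) ξ = pdV i (pdV k V) ξ := by
    ext a
    exact pd_comm (hV a) k i
  have hXd : DifferentiableAt ℝ X ξ := hX.differentiableAt (by norm_num)
  have hCd : ∀ b a c, DifferentiableAt ℝ (fun z => chrM G b z a c) (X ξ) := fun b =>
    diffM_chrM hG2 h b
  have htd : ∀ b i, DifferentiableAt ℝ (fun ζ => tangentM X ζ b i) ξ := fun b i =>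
    diffV_tangent hX i b
  have h2 : ∀ k i, pdM k (pullConn G X i) ξ =
      ∑ b, (pd k (fun ζ => tangentM X ζ b i) ξ • chrM G b (X ξ) +
        tangentM X ξ b i • ∑ d, tangentM X ξ d k • pdM d (chrM G b) (X ξ)) := by
    intro k i
    ext a c
    simp only [pdM, pullConn, Matrix.of_apply, Matrix.sum_apply, Matrix.smul_apply, smul_eq_mul,
      Matrix.add_apply]
    have hCX : ∀ b, DifferentiableAt ℝ (fun ζ => chrM G b (X ζ) a c) ξ := fun b =>
      (hCd b a c).comp ξ hXd
    rw [pd_sum k _ fun b _ => (htd b i).fun_mul (hCX b)]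
    refine Finset.sum_congr rfl fun b _ => ?_
    rw [pd_mul k (htd b i) (hCX b)]
    congr 2
    exact pd_comp (f := fun z => chrM G b z a c) k (hCd b a c) hXd
  have hpt : ∀ b, pd k (fun ζ => tangentM X ζ b i) ξ = pd i (fun ζ => tangentM X ζ b k) ξ := fun b =>
    pd_comm (f := fun ζ => X ζ b) ((contDiffAt_piLp 2).1 hX b) k i
  -- The curvature of the pulled back connection is the pulled back curvature: terms with second
  -- derivatives of X are symmetric in i and k and cancel.
  have h3 : pdM k (pullConn G X i) ξ - pdM i (pullConn G X k) ξ +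
      (pullConn G X k ξ * pullConn G X i ξ - pullConn G X i ξ * pullConn G X k ξ) =
      ∑ d, ∑ b, (tangentM X ξ d k * tangentM X ξ b i) •
        (pdM d (chrM G b) (X ξ) - pdM b (chrM G d) (X ξ) +
          (chrM G d (X ξ) * chrM G b (X ξ) - chrM G b (X ξ) * chrM G d (X ξ))) := by
    have e1 : ∀ k i, pullConn G X k ξ * pullConn G X i ξ =
        ∑ d, ∑ b, (tangentM X ξ d k * tangentM X ξ b i) • (chrM G d (X ξ) * chrM G b (X ξ)) := by
      intro k i
      simp only [pullConn, Finset.sum_mul, Finset.mul_sum, Matrix.smul_mul, Matrix.mul_smul,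
        smul_smul]
      rw [Finset.sum_comm]
      exact Finset.sum_congr rfl fun d _ => Finset.sum_congr rfl fun b _ => by rw [mul_comm]
    have e2 : pullConn G X i ξ * pullConn G X k ξ =
        ∑ d, ∑ b, (tangentM X ξ d k * tangentM X ξ b i) • (chrM G b (X ξ) * chrM G d (X ξ)) := by
      rw [e1, Finset.sum_comm]
      exact Finset.sum_congr rfl fun d _ => Finset.sum_congr rfl fun b _ => by rw [mul_comm]
    rw [h2, h2, e1 k i, e2]
    simp only [hpt, Finset.sum_add_distrib, smul_sub, smul_add, Finset.sum_sub_distrib,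
      Finset.smul_sum, smul_smul]
    rw [Finset.sum_comm (f := fun b d => (tangentM X ξ b i * tangentM X ξ d k) •
      pdM d (chrM G b) (X ξ))]
    simp only [mul_comm (tangentM X ξ _ i) (tangentM X ξ _ k)]
    abel
  have h4 : covAlong G X k (covAlong G X i V) ξ - covAlong G X i (covAlong G X k V) ξ =
      (∑ d, ∑ b, (tangentM X ξ d k * tangentM X ξ b i) •
        (pdM d (chrM G b) (X ξ) - pdM b (chrM G d) (X ξ) +
          (chrM G d (X ξ) * chrM G b (X ξ) - chrM G b (X ξ) * chrM G d (X ξ)))) *ᵥ V ξ := by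
    rw [← h3, h1, h1, hsym, Matrix.add_mulVec, Matrix.sub_mulVec, Matrix.sub_mulVec]
    abel
  rw [h4, Matrix.mulVec_mulVec]
  simp only [Finset.mul_sum, Matrix.mul_smul, riemannForm, dotProduct, Matrix.mulVec,
    Matrix.sum_apply, Matrix.smul_apply, ← riemann_eq hG, Finset.sum_mul, smul_eq_mul,
    Matrix.col_apply]
  refine Finset.sum_congr rfl fun a _ => Finset.sum_congr rfl fun b _ =>
    Finset.sum_congr rfl fun c _ => Finset.sum_congr rfl fun d _ => ?_
  ring

end Local

/-! ### Hypersurfaces in coordinates: Weingarten, Codazzi and the divergence theorems. -/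

/-- The coordinate data of a spacelike hypersurface with unit normal `ν`. -/
structure IsLocalHypersurface {n : ℕ}
    (G : EuclideanSpace ℝ (Fin (n + 1)) → Matrix (Fin (n + 1)) (Fin (n + 1)) ℝ)
    (X : EuclideanSpace ℝ (Fin n) → EuclideanSpace ℝ (Fin (n + 1)))
    (ν : EuclideanSpace ℝ (Fin n) → Fin (n + 1) → ℝ) (U : Set (EuclideanSpace ℝ (Fin n))) :
    Prop where
  isOpen : IsOpen U
  symm : ∀ z, (G z).IsSymm
  contDiffAt_metric : ∀ ξ ∈ U, ∀ a b, ContDiffAt ℝ 2 (fun z => G z a b) (X ξ)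
  det_ne_zero : ∀ ξ ∈ U, (G (X ξ)).det ≠ 0
  contDiffAt_coord : ∀ ξ ∈ U, ContDiffAt ℝ 3 X ξ
  posDef : ∀ ξ ∈ U, (indMetric G X ξ).PosDef
  orthogonal : ∀ ξ ∈ U, ∀ i, ν ξ ⬝ᵥ G (X ξ) *ᵥ (tangentM X ξ).col i = 0
  unit : ∀ ξ ∈ U, |ν ξ ⬝ᵥ G (X ξ) *ᵥ ν ξ| = 1
  continuousAt : ∀ ξ ∈ U, ContinuousAt ν ξ

namespace IsLocalHypersurface

variable {n : ℕ} {G : EuclideanSpace ℝ (Fin (n + 1)) → Matrix (Fin (n + 1)) (Fin (n + 1)) ℝ}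
  {X : EuclideanSpace ℝ (Fin n) → EuclideanSpace ℝ (Fin (n + 1))}
  {ν : EuclideanSpace ℝ (Fin n) → Fin (n + 1) → ℝ} {U : Set (EuclideanSpace ℝ (Fin n))}
  {ξ : EuclideanSpace ℝ (Fin n)}

theorem eventually_mem (S : IsLocalHypersurface G X ν U) (hξ : ξ ∈ U) :
    ∀ᶠ ζ in 𝓝 ξ, ζ ∈ U := S.isOpen.mem_nhds hξ

theorem contDiffAt_two (S : IsLocalHypersurface G X ν U) (hξ : ξ ∈ U) :
    ContDiffAt ℝ 2 X ξ := (S.contDiffAt_coord ξ hξ).of_le (by norm_num)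

theorem differentiableAt_coord (S : IsLocalHypersurface G X ν U) (hξ : ξ ∈ U) :
    DifferentiableAt ℝ X ξ :=
  (S.contDiffAt_two hξ).differentiableAt (by norm_num)

theorem diffM_metric (S : IsLocalHypersurface G X ν U) (hξ : ξ ∈ U) : DiffM G (X ξ) := fun a b =>
  (S.contDiffAt_metric ξ hξ a b).differentiableAt (by norm_num)

theorem diffM_comp_metric (S : IsLocalHypersurface G X ν U) (hξ : ξ ∈ U) :
    DiffM (fun ζ => G (X ζ)) ξ := fun a b =>
  (S.diffM_metric hξ a b).comp ξ (S.differentiableAt_coord hξ)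

theorem diffM_tangentM (S : IsLocalHypersurface G X ν U) (hξ : ξ ∈ U) :
    DiffM (tangentM X) ξ := fun a i => diffV_tangent (S.contDiffAt_two hξ) i a

theorem ind_det_ne_zero (S : IsLocalHypersurface G X ν U) (hξ : ξ ∈ U) :
    (indMetric G X ξ).det ≠ 0 := (S.posDef ξ hξ).det_pos.ne'

theorem unit_mul_self (S : IsLocalHypersurface G X ν U) (hξ : ξ ∈ U) :
    (ν ξ ⬝ᵥ G (X ξ) *ᵥ ν ξ) * (ν ξ ⬝ᵥ G (X ξ) *ᵥ ν ξ) = 1 := by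
  rw [← abs_mul_abs_self, S.unit ξ hξ, one_mul]

theorem diffM_indMetric (S : IsLocalHypersurface G X ν U) (hξ : ξ ∈ U) :
    DiffM (indMetric G X) ξ := by
  have : indMetric G X = fun ζ => (tangentM X ζ)ᵀ * G (X ζ) * tangentM X ζ :=
    funext fun ζ => indMetric_eq
  rw [this]
  exact ((S.diffM_tangentM hξ).transpose.mul (S.diffM_comp_metric hξ)).mul (S.diffM_tangentM hξ)

theorem decomp (S : IsLocalHypersurface G X ν U) (hξ : ξ ∈ U) (w : Fin (n + 1) → ℝ) :
    w = tangentM X ξ *ᵥ ((indMetric G X ξ)⁻¹ *ᵥ ((tangentM X ξ)ᵀ *ᵥ (G (X ξ) *ᵥ w))) +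
      ((ν ξ ⬝ᵥ G (X ξ) *ᵥ ν ξ) * (ν ξ ⬝ᵥ G (X ξ) *ᵥ w)) • ν ξ := by
  have h := frame_decomp (by rw [← indMetric_eq]; exact S.ind_det_ne_zero hξ) (S.symm _)
    (S.orthogonal ξ hξ) rfl (S.unit_mul_self hξ) w
  rw [← indMetric_eq] at h
  simpa only [Matrix.mulVec_mulVec, Matrix.mul_assoc] using h

/-- Up to a factor the normal is algebraic in the first derivatives of X. Fix w = ν(ξ) and remove
its tangential part at nearby points: the result N is differentiable and equals cν with c continuous
and c(ξ) = 1. Since ⟨ν,ν⟩² = 1, ⟨N,N⟩² = c⁴, so near ξ the positive factor c is a fourth root of a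
differentiable function and ν = N/c. -/
theorem diffV_normal (S : IsLocalHypersurface G X ν U) (hξ : ξ ∈ U) : DiffV ν ξ := by
  set w := ν ξ with hw
  set N : EuclideanSpace ℝ (Fin n) → Fin (n + 1) → ℝ := fun ζ =>
    w + (-tangentM X ζ) *ᵥ ((indMetric G X ζ)⁻¹ *ᵥ ((tangentM X ζ)ᵀ *ᵥ (G (X ζ) *ᵥ w))) with hN
  have hwd : DiffV (fun _ : EuclideanSpace ℝ (Fin n) => w) ξ := fun a => differentiableAt_const _
  have hNd : DiffV N ξ := by
    have h1 : DiffM (fun ζ => -tangentM X ζ) ξ := fun a b => (S.diffM_tangentM hξ a b).neg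
    exact hwd.add (h1.mulVec (((S.diffM_indMetric hξ).inv (S.ind_det_ne_zero hξ)).mulVec
      ((S.diffM_tangentM hξ).transpose.mulVec ((S.diffM_comp_metric hξ).mulVec hwd))))
  set c : EuclideanSpace ℝ (Fin n) → ℝ := fun ζ =>
    (ν ζ ⬝ᵥ G (X ζ) *ᵥ ν ζ) * (ν ζ ⬝ᵥ G (X ζ) *ᵥ w) with hc
  have hNc : ∀ ζ ∈ U, N ζ = c ζ • ν ζ := fun ζ hζ => by
    have h := S.decomp hζ w
    simp only [hN, Matrix.neg_mulVec]
    rw [← sub_eq_add_neg, sub_eq_iff_eq_add']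
    exact h
  have hGc : ContinuousAt (fun ζ => G (X ζ)) ξ := continuousAt_pi.2 fun a => continuousAt_pi.2
    fun b => (S.diffM_comp_metric hξ a b).continuousAt
  have hνc := S.continuousAt ξ hξ
  have hcc : ContinuousAt c ξ := by
    have : Continuous fun p : (Fin (n + 1) → ℝ) × Matrix (Fin (n + 1)) (Fin (n + 1)) ℝ =>
        (p.1 ⬝ᵥ p.2 *ᵥ p.1) * (p.1 ⬝ᵥ p.2 *ᵥ w) := by fun_prop
    exact this.continuousAt.comp (hνc.prodMk hGc)
  have hc1 : c ξ = 1 := S.unit_mul_self hξ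
  set f : EuclideanSpace ℝ (Fin n) → ℝ := fun ζ => (N ζ ⬝ᵥ G (X ζ) *ᵥ N ζ) ^ 2 with hf
  have hfc : ∀ ζ ∈ U, f ζ = (c ζ ^ 2) ^ 2 := fun ζ hζ => by
    simp only [hf, hNc ζ hζ, Matrix.mulVec_smul, dotProduct_smul, smul_dotProduct, smul_eq_mul]
    linear_combination c ζ ^ 4 * S.unit_mul_self hζ
  have hfd : DifferentiableAt ℝ f ξ :=
    (hNd.dotProduct ((S.diffM_comp_metric hξ).mulVec hNd)).pow 2
  have hf1 : f ξ = 1 := by rw [hfc ξ hξ, hc1]; norm_num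
  have hsd : DifferentiableAt ℝ (fun ζ => (√(√(f ζ)))⁻¹) ξ := by
    refine ((hfd.sqrt ?_).sqrt ?_).inv ?_ <;> simp [hf1]
  have hev : ∀ᶠ ζ in 𝓝 ξ, ν ζ = (√(√(f ζ)))⁻¹ • N ζ := by
    filter_upwards [S.eventually_mem hξ, hcc.eventually (lt_mem_nhds (b := c ξ) (a := 0)
      (by rw [hc1]; norm_num))] with ζ hζ hcζ
    rw [hfc ζ hζ, Real.sqrt_sq (sq_nonneg _), Real.sqrt_sq hcζ.le, hNc ζ hζ, smul_smul,
      inv_mul_cancel₀ hcζ.ne', one_smul]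
  intro a
  exact (hsd.mul (hNd a)).congr_of_eventuallyEq (hev.mono fun ζ hζ => congrFun hζ a)

/-- Differentiating ⟨ν,ν⟩² = 1 instead of ⟨ν,ν⟩ = σ covers both signs without showing first that σ
is locally constant. -/
theorem covAlong_normal_normal (S : IsLocalHypersurface G X ν U) (hξ : ξ ∈ U)
    (k : Fin n) : ν ξ ⬝ᵥ G (X ξ) *ᵥ covAlong G X k ν ξ = 0 := by
  have hν := S.diffV_normal hξ
  have hf := hν.dotProduct ((S.diffM_comp_metric hξ).mulVec hν)
  have h1 : pd k (fun ζ => (ν ζ ⬝ᵥ G (X ζ) *ᵥ ν ζ) * (ν ζ ⬝ᵥ G (X ζ) *ᵥ ν ζ)) ξ = 0 := by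
    rw [pd_congr k ((S.eventually_mem hξ).mono fun ζ hζ => S.unit_mul_self hζ), pd_const]
  rw [pd_mul k hf hf, pd_bilin S.symm (S.diffM_metric hξ) (S.det_ne_zero ξ hξ)
    (S.differentiableAt_coord hξ) k hν hν, bilin_comm (S.symm _) _ (ν ξ)] at h1
  have h2 := S.unit_mul_self hξ
  linear_combination (1 / 4) * (ν ξ ⬝ᵥ G (X ξ) *ᵥ ν ξ) * h1 -
    (ν ξ ⬝ᵥ G (X ξ) *ᵥ covAlong G X k ν ξ) * h2

/-- The induced Christoffel symbols multiply tangent vectors, which are orthogonal to ν, so they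
drop out. -/
theorem secondForm_apply (S : IsLocalHypersurface G X ν U) (hξ : ξ ∈ U)
    (i j : Fin n) : secondForm G X ν ξ i j =
    -(covAlong G X i (fun ζ => (tangentM X ζ).col j) ξ ⬝ᵥ G (X ξ) *ᵥ ν ξ) := by
  have h1 : secondForm G X ν ξ i j = -((covAlong G X i (fun ζ => (tangentM X ζ).col j) ξ -
      ∑ k, christoffel (indMetric G X) k i j ξ • (tangentM X ξ).col k) ⬝ᵥ G (X ξ) *ᵥ ν ξ) := by
    simp only [secondForm, Matrix.of_apply, dotProduct, Pi.sub_apply,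
      covAlong, Pi.add_apply, pullConn_mulVec_col, Finset.sum_apply, Pi.smul_apply, smul_eq_mul,
      Matrix.col_apply, pdV]
    congr 1
    refine Finset.sum_congr rfl fun a _ => ?_
    change _ = _ * ∑ b, G (X ξ) a b * ν ξ b
    rw [Finset.mul_sum]
    exact Finset.sum_congr rfl fun b _ => by ring
  have h2 : ∀ k, (tangentM X ξ).col k ⬝ᵥ G (X ξ) *ᵥ ν ξ = 0 := fun k =>
    (bilin_comm (S.symm _) _ _).trans (S.orthogonal ξ hξ k)
  rw [h1, sub_dotProduct, sum_dotProduct]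
  simp only [smul_dotProduct, h2, smul_zero, Finset.sum_const_zero, sub_zero]

theorem secondForm_symm (S : IsLocalHypersurface G X ν U) (hξ : ξ ∈ U) :
    (secondForm G X ν ξ).IsSymm := by
  ext i j
  rw [Matrix.transpose_apply, S.secondForm_apply hξ, S.secondForm_apply hξ,
    covAlong_tangent_comm S.symm (S.contDiffAt_two hξ)]

/-- Here the full regularity enters: X of class C³ and the ambient metric of class C². It makes the
second fundamental form differentiable. -/
theorem diffV_covAlong_tangent (S : IsLocalHypersurface G X ν U) (hξ : ξ ∈ U) (i j : Fin n) :
    DiffV (covAlong G X i fun ζ => (tangentM X ζ).col j) ξ := by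
  have h1 : DiffV (pdV i fun ζ => (tangentM X ζ).col j) ξ := fun a =>
    (contDiffAt_pd (l := 1) (contDiffAt_tangentM (l := 2) (S.contDiffAt_coord ξ hξ)
      (by norm_num) a j) (by norm_num) i).differentiableAt (by norm_num)
  have h2 : DiffM (pullConn G X i) ξ := fun a b => (contDiffAt_pullConn (S.contDiffAt_metric ξ hξ)
    (S.det_ne_zero ξ hξ) (S.contDiffAt_two hξ) i a b).differentiableAt (by norm_num)
  exact h1.add (h2.mulVec (diffV_tangent (S.contDiffAt_two hξ) j))

theorem secondForm_eventuallyEq (S : IsLocalHypersurface G X ν U) (hξ : ξ ∈ U) (i j : Fin n) :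
    (fun ζ => secondForm G X ν ζ i j) =ᶠ[𝓝 ξ] fun ζ =>
      -(covAlong G X i (fun ζ => (tangentM X ζ).col j) ζ ⬝ᵥ G (X ζ) *ᵥ ν ζ) :=
  (S.eventually_mem hξ).mono fun _ hζ => S.secondForm_apply hζ i j

theorem diffM_secondForm (S : IsLocalHypersurface G X ν U) (hξ : ξ ∈ U) :
    DiffM (secondForm G X ν) ξ := fun i j =>
  ((S.diffV_covAlong_tangent hξ i j).dotProduct ((S.diffM_comp_metric hξ).mulVec
    (S.diffV_normal hξ))).neg.congr_of_eventuallyEq (S.secondForm_eventuallyEq hξ i j)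

/-- The Weingarten equation. -/
theorem tangent_covAlong_normal (S : IsLocalHypersurface G X ν U) (hξ : ξ ∈ U) (k l : Fin n) :
    (tangentM X ξ).col l ⬝ᵥ G (X ξ) *ᵥ covAlong G X k ν ξ = secondForm G X ν ξ k l := by
  have h1 : pd k (fun ζ => (tangentM X ζ).col l ⬝ᵥ G (X ζ) *ᵥ ν ζ) ξ = 0 := by
    rw [pd_congr k ((S.eventually_mem hξ).mono fun ζ hζ => (bilin_comm (S.symm _) _ _).trans
      (S.orthogonal ζ hζ l)), pd_const]
  rw [pd_bilin S.symm (S.diffM_metric hξ) (S.det_ne_zero ξ hξ) (S.differentiableAt_coord hξ) k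
    (diffV_tangent (S.contDiffAt_two hξ) l) (S.diffV_normal hξ)] at h1
  rw [S.secondForm_apply hξ]
  linear_combination h1

/-- As ∇_k ν has no normal component, only the tangential part of ∇_i x_j counts. Its coefficients
are the induced Christoffel symbols, and the Weingarten equation evaluates the remaining products.
-/
theorem covAlong_tangent_covAlong_normal (S : IsLocalHypersurface G X ν U) (hξ : ξ ∈ U)
    (i j k : Fin n) :
    covAlong G X i (fun ζ => (tangentM X ζ).col j) ξ ⬝ᵥ G (X ξ) *ᵥ covAlong G X k ν ξ =
      ∑ l, christoffel (indMetric G X) l i j ξ * secondForm G X ν ξ k l := by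
  set u := covAlong G X i (fun ζ => (tangentM X ζ).col j) ξ with hu
  have h1 : (tangentM X ξ)ᵀ *ᵥ (G (X ξ) *ᵥ u) =
      indMetric G X ξ *ᵥ fun l => christoffel (indMetric G X) l i j ξ := by
    ext k
    exact (sum_indMetric_mul_christoffel S.symm (S.diffM_metric hξ) (S.det_ne_zero ξ hξ)
      (S.contDiffAt_two hξ) (S.ind_det_ne_zero hξ) i j k).symm
  rw [S.decomp hξ u, h1, Matrix.mulVec_mulVec _ (indMetric G X ξ)⁻¹ (indMetric G X ξ),
    Matrix.nonsing_inv_mul _ (S.ind_det_ne_zero hξ).isUnit, Matrix.one_mulVec, add_dotProduct,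
    smul_dotProduct, S.covAlong_normal_normal hξ, smul_zero, add_zero,
    Matrix.mulVec_eq_sum, sum_dotProduct]
  refine Finset.sum_congr rfl fun l _ => ?_
  rw [op_smul_eq_smul, smul_dotProduct, smul_eq_mul]
  congr 1
  exact S.tangent_covAlong_normal hξ k l

/-- The Codazzi equation. -/
theorem codazzi (S : IsLocalHypersurface G X ν U) (hξ : ξ ∈ U) (i j k : Fin n) :
    covLower (indMetric G X) (secondForm G X ν) k ξ i j -
      covLower (indMetric G X) (secondForm G X ν) i ξ k j =
    -riemannForm G (X ξ) (ν ξ) ((tangentM X ξ).col j) ((tangentM X ξ).col k)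
      ((tangentM X ξ).col i) := by
  -- The sum Γ^l_{ij} h_{kl} produced by differentiating ν turns, under i ↔ k, into the connection
  -- term Γ^l_{kj} h_{il} of h_{ij;k}. So these cancel in the difference, and only the commutator of
  -- covariant derivatives of x_j survives.
  have h1 : ∀ k i, pd k (fun ζ => secondForm G X ν ζ i j) ξ =
      -(ν ξ ⬝ᵥ G (X ξ) *ᵥ covAlong G X k (covAlong G X i fun ζ => (tangentM X ζ).col j) ξ) -
        ∑ l, christoffel (indMetric G X) l i j ξ * secondForm G X ν ξ k l := by
    intro k i
    rw [pd_congr k (S.secondForm_eventuallyEq hξ i j), pd_neg, pd_bilin S.symm (S.diffM_metric hξ)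
      (S.det_ne_zero ξ hξ) (S.differentiableAt_coord hξ) k (S.diffV_covAlong_tangent hξ i j)
      (S.diffV_normal hξ), S.covAlong_tangent_covAlong_normal hξ, bilin_comm (S.symm _) (ν ξ)]
    ring
  have h2 : ∀ k i, covLower (indMetric G X) (secondForm G X ν) k ξ i j =
      pd k (fun ζ => secondForm G X ν ζ i j) ξ -
        ∑ l, christoffel (indMetric G X) l k i ξ * secondForm G X ν ξ l j -
        ∑ l, christoffel (indMetric G X) l k j ξ * secondForm G X ν ξ i l := by
    intro k i
    simp only [covLower, Matrix.sub_apply, Matrix.mul_apply, Matrix.transpose_apply, chrM,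
      Matrix.of_apply, pdM, mul_comm (secondForm G X ν ξ i _)]
  rw [h2, h2, h1, h1, ← covAlong_comm (V := fun ζ => (tangentM X ζ).col j) S.symm
    (S.contDiffAt_metric ξ hξ) (S.det_ne_zero ξ hξ) (S.contDiffAt_two hξ)
    (fun a => contDiffAt_tangentM (S.contDiffAt_coord ξ hξ) (by norm_num) a j),
    Matrix.mulVec_sub, dotProduct_sub]
  have h3 : ∀ l, christoffel (indMetric G X) l k i = christoffel (indMetric G X) l i k :=
    fun l => christoffel_symm (fun z => indMetric_isSymm S.symm) l k i
  simp only [h3]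
  ring

/-- The Codazzi equation with one index raised; symmetry of h_{ip;j} in i and p brings the indices
into position. -/
theorem covMixed_sub (S : IsLocalHypersurface G X ν U) (hξ : ξ ∈ U) (i j l : Fin n) :
    covMixed (indMetric G X) (fun z => (indMetric G X z)⁻¹ * secondForm G X ν z) j ξ l i -
      covMixed (indMetric G X) (fun z => (indMetric G X z)⁻¹ * secondForm G X ν z) i ξ l j =
    -∑ p, (indMetric G X ξ)⁻¹ l p * riemannForm G (X ξ) (ν ξ) ((tangentM X ξ).col p)
      ((tangentM X ξ).col j) ((tangentM X ξ).col i) := by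
  have hsymm : ∀ j, (covLower (indMetric G X) (secondForm G X ν) j ξ).IsSymm := by
    intro j
    have h1 : (pdM j (secondForm G X ν) ξ)ᵀ = pdM j (secondForm G X ν) ξ := by
      rw [← pdM_transpose]
      exact pdM_congr j ((S.eventually_mem hξ).mono fun ζ hζ => S.secondForm_symm hζ)
    rw [Matrix.IsSymm, covLower, Matrix.transpose_sub, Matrix.transpose_sub, h1,
      Matrix.transpose_mul, Matrix.transpose_mul, (S.secondForm_symm hξ).eq,
      Matrix.transpose_transpose, sub_right_comm]
  rw [covMixed_inv_mul (fun z => indMetric_isSymm S.symm) (S.diffM_indMetric hξ)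
    (S.diffM_secondForm hξ) (S.ind_det_ne_zero hξ), covMixed_inv_mul
    (fun z => indMetric_isSymm S.symm) (S.diffM_indMetric hξ) (S.diffM_secondForm hξ)
    (S.ind_det_ne_zero hξ), Matrix.mul_apply, Matrix.mul_apply, ← Finset.sum_sub_distrib,
    ← Finset.sum_neg_distrib]
  refine Finset.sum_congr rfl fun p _ => ?_
  rw [← mul_sub, (hsymm j).apply i p, (hsymm i).apply j p, S.codazzi hξ i p j, mul_neg]

theorem covMixed_comm_of_sectionalCurvature (S : IsLocalHypersurface G X ν U) (hξ : ξ ∈ U) {K : ℝ}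
    (hK : ∀ v w, planeForm (G (X ξ)) v w ≠ 0 → sectionalCurvature G (X ξ) v w = K) (i j l : Fin n) :
    covMixed (indMetric G X) (fun z => (indMetric G X z)⁻¹ * secondForm G X ν z) j ξ l i =
      covMixed (indMetric G X) (fun z => (indMetric G X z)⁻¹ * secondForm G X ν z) i ξ l j := by
  rw [← sub_eq_zero, S.covMixed_sub hξ, neg_eq_zero]
  -- The plane of ν and x_i supplies the required nondegenerate plane: its form is ⟨ν,ν⟩⟨x_i,x_i⟩,
  -- and the induced metric is positive.
  have h₀ : planeForm (G (X ξ)) (ν ξ) ((tangentM X ξ).col i) ≠ 0 := by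
    rw [planeForm, S.orthogonal ξ hξ, ← indMetric_apply]
    have h1 := (S.posDef ξ hξ).diag_pos (i := i)
    have h2 : ν ξ ⬝ᵥ G (X ξ) *ᵥ ν ξ ≠ 0 := by
      intro h
      have := S.unit_mul_self hξ
      simp [h] at this
    simpa using ⟨h2, h1.ne'⟩
  refine Finset.sum_eq_zero fun p _ => ?_
  rw [riemannForm_of_sectionalCurvature S.symm (S.contDiffAt_metric ξ hξ) (S.det_ne_zero ξ hξ) hK h₀,
    S.orthogonal ξ hξ, S.orthogonal ξ hξ]
  simp

/-- Completeness of the frame exhibits g^{jp} x_j x_p + σ ν ν as a left inverse of the ambient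
metric, hence as its inverse. -/
theorem sum_inv_mul_tangent (S : IsLocalHypersurface G X ν U) (hξ : ξ ∈ U) (b c : Fin (n + 1)) :
    ∑ j, ∑ p, (indMetric G X ξ)⁻¹ j p * tangentM X ξ c j * tangentM X ξ b p =
      (G (X ξ))⁻¹ c b - (ν ξ ⬝ᵥ G (X ξ) *ᵥ ν ξ) * ν ξ c * ν ξ b := by
  have h := frame_complete (by rw [← indMetric_eq]; exact S.ind_det_ne_zero hξ) (S.symm _)
    (S.orthogonal ξ hξ) rfl (S.unit_mul_self hξ)
  rw [← indMetric_eq, ← smul_mul_assoc, ← add_mul] at h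
  have h2 := congrFun (congrFun (Matrix.inv_eq_left_inv h) c) b
  rw [h2, Matrix.add_apply, Matrix.smul_apply, Matrix.vecMulVec_apply, smul_eq_mul, mul_assoc _ (ν ξ c),
    add_sub_cancel_right, Matrix.mul_apply]
  simp only [Matrix.mul_apply, Matrix.transpose_apply, Finset.sum_mul]
  rw [Finset.sum_comm]
  exact Finset.sum_congr rfl fun p _ => Finset.sum_congr rfl fun j _ => by ring

/-- Replace g^{jp} x_j x_p by the inverse ambient metric minus σ ν ν. The normal part vanishes by
skew symmetry in the first two slots, and the rest is -Ric(ν, x_i) = -c⟨ν, x_i⟩ = 0. -/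
theorem sum_riemannForm_of_einstein (S : IsLocalHypersurface G X ν U) (hξ : ξ ∈ U)
    {c : ℝ} (hc : ∀ a b, ricci G a b (X ξ) = c * G (X ξ) a b)
    (i : Fin n) :
    ∑ j, ∑ p, (indMetric G X ξ)⁻¹ j p * riemannForm G (X ξ) (ν ξ) ((tangentM X ξ).col p)
      ((tangentM X ξ).col j) ((tangentM X ξ).col i) = 0 := by
  have hν : riemannForm G (X ξ) (ν ξ) (ν ξ) (ν ξ) ((tangentM X ξ).col i) = 0 := by
    have := riemannForm_swap_left S.symm (S.contDiffAt_metric ξ hξ) (S.det_ne_zero ξ hξ) (ν ξ) (ν ξ)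
      (ν ξ) ((tangentM X ξ).col i)
    linarith
  have h1 : ∑ j, ∑ p, (indMetric G X ξ)⁻¹ j p * riemannForm G (X ξ) (ν ξ) ((tangentM X ξ).col p)
      ((tangentM X ξ).col j) ((tangentM X ξ).col i) =
      ∑ a, ∑ b, ∑ e, ∑ d, (∑ j, ∑ p, (indMetric G X ξ)⁻¹ j p * tangentM X ξ e j * tangentM X ξ b p) *
        (riemann G a b e d (X ξ) * ν ξ a * tangentM X ξ d i) := by
    simp only [riemannForm, Matrix.col_apply, Finset.mul_sum, Finset.sum_mul]
    -- Fixing the two index types moves ambient sums outside hypersurface sums only, so the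
    -- rewriting terminates.
    simp only [Finset.sum_comm (s := (Finset.univ : Finset (Fin n)))
      (t := (Finset.univ : Finset (Fin (n + 1))))]
    refine Finset.sum_congr rfl fun a _ => Finset.sum_congr rfl fun b _ =>
      Finset.sum_congr rfl fun e _ => Finset.sum_congr rfl fun d _ =>
      Finset.sum_congr rfl fun j _ => Finset.sum_congr rfl fun p _ => ?_
    ring
  have h2 : ∑ a, ∑ b, ∑ e, ∑ d, (G (X ξ))⁻¹ e b *
      (riemann G a b e d (X ξ) * ν ξ a * tangentM X ξ d i) =
      ∑ a, ∑ d, (∑ b, ∑ e, (G (X ξ))⁻¹ e b * riemann G a b e d (X ξ)) *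
        (ν ξ a * tangentM X ξ d i) := by
    refine Finset.sum_congr rfl fun a _ => ?_
    simp only [Finset.sum_mul]
    rw [Finset.sum_comm (f := fun d b => ∑ e, (G (X ξ))⁻¹ e b * riemann G a b e d (X ξ) *
      (ν ξ a * tangentM X ξ d i))]
    refine Finset.sum_congr rfl fun b _ => ?_
    rw [Finset.sum_comm]
    exact Finset.sum_congr rfl fun d _ => Finset.sum_congr rfl fun e _ => by ring
  have h3 : ∑ a, ∑ b, ∑ e, ∑ d, ((ν ξ ⬝ᵥ G (X ξ) *ᵥ ν ξ) * ν ξ e * ν ξ b) *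
      (riemann G a b e d (X ξ) * ν ξ a * tangentM X ξ d i) =
      (ν ξ ⬝ᵥ G (X ξ) *ᵥ ν ξ) * riemannForm G (X ξ) (ν ξ) (ν ξ) (ν ξ) ((tangentM X ξ).col i) := by
    simp only [riemannForm, Finset.mul_sum, Matrix.col_apply]
    exact Finset.sum_congr rfl fun a _ => Finset.sum_congr rfl fun b _ =>
      Finset.sum_congr rfl fun e _ => Finset.sum_congr rfl fun d _ => by ring
  rw [h1]
  simp only [S.sum_inv_mul_tangent hξ, sub_mul, Finset.sum_sub_distrib]
  rw [h2, h3, hν, mul_zero, sub_zero]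
  simp only [sum_inv_mul_riemann S.symm (S.contDiffAt_metric ξ hξ) (S.det_ne_zero ξ hξ), hc]
  have h4 := S.orthogonal ξ hξ i
  simp only [dotProduct, Matrix.mulVec, Matrix.col_apply, Finset.mul_sum] at h4
  calc _ = -c * ∑ a, ∑ d, ν ξ a * (G (X ξ) a d * tangentM X ξ d i) := by
        simp only [Finset.mul_sum]
        exact Finset.sum_congr rfl fun a _ => Finset.sum_congr rfl fun d _ => by ring
    _ = 0 := by rw [h4, mul_zero]

theorem divergenceFree_of_sum_covMixed (S : IsLocalHypersurface G X ν U) (hξ : ξ ∈ U)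
    (k : ℕ) (hk : k + 1 ≤ n)
    (h : ∀ i, ∑ j, covMixed (indMetric G X)
      (fun z => newton k ((indMetric G X z)⁻¹ * secondForm G X ν z)) j ξ j i = 0) :
    DivergenceFreeAt (indMetric G X)
      (fun ζ => curvatureDeriv (elemSymm n (k + 1)) (secondForm G X ν ζ) (indMetric G X ζ)) ξ :=
  divergenceFreeAt_newton (fun _ => indMetric_isSymm S.symm) (S.diffM_indMetric hξ)
    (S.diffM_secondForm hξ) (S.ind_det_ne_zero hξ)
    ((S.eventually_mem hξ).mono fun _ hζ => S.secondForm_symm hζ) k ((-1) ^ k) h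
    ((S.eventually_mem hξ).mono fun ζ hζ =>
      curvatureDeriv_elemSymm (S.secondForm_symm hζ) (S.posDef ζ hζ) k hk)

theorem divergenceFree_of_sectionalCurvature (S : IsLocalHypersurface G X ν U) (hξ : ξ ∈ U) {K : ℝ}
    (hK : ∀ v w, planeForm (G (X ξ)) v w ≠ 0 → sectionalCurvature G (X ξ) v w = K)
    (k : ℕ) (hk : k + 1 ≤ n) :
    DivergenceFreeAt (indMetric G X)
      (fun ζ => curvatureDeriv (elemSymm n (k + 1)) (secondForm G X ν ζ) (indMetric G X ζ)) ξ :=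
  S.divergenceFree_of_sum_covMixed hξ k hk (sum_covMixed_newton
    (((S.diffM_indMetric hξ).inv (S.ind_det_ne_zero hξ)).mul (S.diffM_secondForm hξ))
    (S.covMixed_comm_of_sectionalCurvature hξ hK) k)

/-- A single step of the recursion from N_0 = 1 suffices, and there only the trace of the Codazzi
equation is needed. -/
theorem divergenceFree_of_einstein (S : IsLocalHypersurface G X ν U) (hξ : ξ ∈ U)
    {c : ℝ} (hc : ∀ a b, ricci G a b (X ξ) = c * G (X ξ) a b)
    (hn : 2 ≤ n) :
    DivergenceFreeAt (indMetric G X)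
      (fun ζ => curvatureDeriv (elemSymm n 2) (secondForm G X ν ζ) (indMetric G X ζ)) ξ := by
  refine S.divergenceFree_of_sum_covMixed hξ 1 hn (sum_covMixed_newton_succ
    (((S.diffM_indMetric hξ).inv (S.ind_det_ne_zero hξ)).mul (S.diffM_secondForm hξ)) 0
    sum_covMixed_newton_zero fun i => ?_)
  rw [newton_zero, one_mul, Matrix.trace, ← sub_eq_zero, ← Finset.sum_sub_distrib]
  simp only [one_mul, Matrix.diag_apply, S.covMixed_sub hξ, Finset.sum_neg_distrib,
    S.sum_riemannForm_of_einstein hξ hc, neg_zero]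

end IsLocalHypersurface

/-! ### Tangent vectors and metrics in charts. -/

section Charts

variable {m : ℕ} {N : Type*} [TopologicalSpace N] [ChartedSpace (EuclideanSpace ℝ (Fin m)) N]
  {φ : OpenPartialHomeomorph N (EuclideanSpace ℝ (Fin m))}

theorem mDifferentiable_of_mem_charts (hφ : φ ∈ charts m N) : φ.MDifferentiable (𝓡 m) (𝓡 m) :=
  ⟨(contMDiffOn_of_mem_maximalAtlas hφ).mdifferentiableOn (by norm_num),
    (contMDiffOn_symm_of_mem_maximalAtlas hφ).mdifferentiableOn (by norm_num)⟩

/-- The coordinates of a tangent vector in the chart `φ`. -/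
def chartVec (φ : OpenPartialHomeomorph N (EuclideanSpace ℝ (Fin m))) (p : N)
    (v : TangentSpace (𝓡 m) p) : EuclideanSpace ℝ (Fin m) :=
  mfderiv (𝓡 m) (𝓡 m) φ p v

/-- The tangent vector with given coordinates in the chart `φ`. -/
def chartVecSymm (φ : OpenPartialHomeomorph N (EuclideanSpace ℝ (Fin m)))
    (y : EuclideanSpace ℝ (Fin m)) : EuclideanSpace ℝ (Fin m) →L[ℝ] TangentSpace (𝓡 m) (φ.symm y) :=
  mfderiv (𝓡 m) (𝓡 m) φ.symm y

theorem form_chartVecSymm (b : ∀ p : N, LinearMap.BilinForm ℝ (TangentSpace (𝓡 m) p))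
    (y v w : EuclideanSpace ℝ (Fin m)) :
    b (φ.symm y) (chartVecSymm φ y v) (chartVecSymm φ y w) =
      v.ofLp ⬝ᵥ components b φ y *ᵥ w.ofLp := by
  have h : ∀ u : EuclideanSpace ℝ (Fin m), chartVecSymm φ y u = ∑ a, u a • coordVector φ y a := by
    intro u
    have h2 : u = ∑ a, u a • EuclideanSpace.single a (1 : ℝ) := by
      ext c
      simp [Finset.sum_apply, Pi.single_apply]
    conv_lhs => rw [h2, map_sum]
    refine Finset.sum_congr rfl fun a _ => ?_
    rw [map_smul]
    rfl
  rw [h, h]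
  simp only [map_sum, LinearMap.sum_apply, map_smul, LinearMap.smul_apply, smul_eq_mul, dotProduct,
    Matrix.mulVec, components, Matrix.of_apply, Finset.mul_sum]
  rw [Finset.sum_comm]
  exact Finset.sum_congr rfl fun a _ => Finset.sum_congr rfl fun c _ => by ring

theorem chartVecSymm_chartVec (hφ : φ ∈ charts m N) {y : EuclideanSpace ℝ (Fin m)}
    (hy : y ∈ φ.target) (v : TangentSpace (𝓡 m) (φ.symm y)) :
    chartVecSymm φ y (chartVec φ (φ.symm y) v) = v := by
  have h1 := congrArg (fun L => L v)
    ((mDifferentiable_of_mem_charts hφ).symm_comp_deriv (φ.map_target hy))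
  rw [φ.right_inv hy] at h1
  exact h1

theorem chartVec_chartVecSymm (hφ : φ ∈ charts m N) {y : EuclideanSpace ℝ (Fin m)}
    (hy : y ∈ φ.target) (v : EuclideanSpace ℝ (Fin m)) :
    chartVec φ (φ.symm y) (chartVecSymm φ y v) = v :=
  congrArg (fun L => L v) ((mDifferentiable_of_mem_charts hφ).comp_symm_deriv hy)

/-- The components of a bilinear form determine it. -/
theorem form_eq_components (b : ∀ p : N, LinearMap.BilinForm ℝ (TangentSpace (𝓡 m) p))
    (hφ : φ ∈ charts m N) {y : EuclideanSpace ℝ (Fin m)} (hy : y ∈ φ.target) {p : N}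
    (hp : φ.symm y = p) (v w : TangentSpace (𝓡 m) p) :
    b p v w = (chartVec φ p v).ofLp ⬝ᵥ components b φ y *ᵥ (chartVec φ p w).ofLp := by
  subst hp
  rw [← form_chartVecSymm, chartVecSymm_chartVec hφ hy, chartVecSymm_chartVec hφ hy]

theorem det_components_ne_zero (g : SemiRiemannianMetric m N) (hφ : φ ∈ charts m N)
    {y : EuclideanSpace ℝ (Fin m)} (hy : y ∈ φ.target) : (components g.form φ y).det ≠ 0 := by
  intro h
  obtain ⟨w, hw, hCw⟩ := Matrix.exists_mulVec_eq_zero_iff.2 h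
  have h1 : chartVecSymm φ y (WithLp.toLp 2 w) = 0 := by
    refine g.nondegenerate _ _ fun v => ?_
    rw [g.symm, ← chartVecSymm_chartVec hφ hy v, form_chartVecSymm]
    simp [hCw]
  have h2 := chartVec_chartVecSymm hφ hy (WithLp.toLp 2 w)
  rw [h1, chartVec, map_zero] at h2
  apply hw
  have h3 := congrArg WithLp.ofLp h2
  exact h3.symm

theorem components_isSymm (g : SemiRiemannianMetric m N)
    (φ : OpenPartialHomeomorph N (EuclideanSpace ℝ (Fin m))) (y : EuclideanSpace ℝ (Fin m)) :
    (components g.form φ y).IsSymm := by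
  ext i j
  exact g.symm _ _ _

theorem contDiffAt_components (g : SemiRiemannianMetric m N) (hφ : φ ∈ charts m N)
    {y : EuclideanSpace ℝ (Fin m)} (hy : y ∈ φ.target) (i j : Fin m) :
    ContDiffAt ℝ 2 (fun z => components g.form φ z i j) y :=
  (g.contDiffOn φ hφ i j).contDiffAt (φ.open_target.mem_nhds hy)

/-- Continuity of ν is given in the tangent bundle. The tangent map of a chart and the
trivialization of the tangent bundle of the model space turn it into continuity of components. -/
theorem continuousOn_chartVec [IsManifold (𝓡 m) 3 N] (hφ : φ ∈ charts m N) :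
    ContinuousOn (fun p : TangentBundle (𝓡 m) N => chartVec φ p.1 p.2)
      (Bundle.TotalSpace.proj ⁻¹' φ.source) := by
  have h1 := (contMDiffOn_of_mem_maximalAtlas hφ).continuousOn_tangentMapWithin (by norm_num)
    φ.open_source.uniqueMDiffOn
  have h2 : Continuous fun q : TangentBundle (𝓡 m) (EuclideanSpace ℝ (Fin m)) =>
      (tangentBundleModelSpaceHomeomorph (𝓡 m) q).2 :=
    continuous_snd.comp (tangentBundleModelSpaceHomeomorph (𝓡 m)).continuous
  refine (h2.comp_continuousOn h1).congr fun p hp => ?_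
  change mfderiv (𝓡 m) (𝓡 m) φ p.1 p.2 = mfderivWithin (𝓡 m) (𝓡 m) φ φ.source p.1 p.2
  rw [mfderivWithin_of_isOpen φ.open_source hp]

end Charts

/-! ### From immersions of manifolds to coordinate data. -/

namespace SpacelikeHypersurface

variable {n : ℕ} {N : Type*} [TopologicalSpace N]
  [ChartedSpace (EuclideanSpace ℝ (Fin (n + 1))) N] [IsManifold (𝓡 (n + 1)) 3 N]
  {g : SemiRiemannianMetric (n + 1) N}
  {M : Type*} [TopologicalSpace M] [ChartedSpace (EuclideanSpace ℝ (Fin n)) M]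
  (S : SpacelikeHypersurface g M)
  {φ : OpenPartialHomeomorph N (EuclideanSpace ℝ (Fin (n + 1)))}
  {ψ : OpenPartialHomeomorph M (EuclideanSpace ℝ (Fin n))}

theorem isOpen_domain : IsOpen (S.domain φ ψ) :=
  ψ.symm.continuousOn.isOpen_inter_preimage ψ.open_target
    (φ.open_source.preimage S.contMDiff.continuous)

variable {ξ : EuclideanSpace ℝ (Fin n)}

theorem contDiffAt_coord (hφ : φ ∈ charts (n + 1) N) (hψ : ψ ∈ charts n M)
    (hξ : ξ ∈ S.domain φ ψ) : ContDiffAt ℝ 3 (S.coord φ ψ) ξ := by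
  rw [← contMDiffAt_iff_contDiffAt]
  exact (contMDiffAt_of_mem_maximalAtlas hφ hξ.2).comp ξ
    (S.contMDiff.contMDiffAt.comp ξ (contMDiffAt_symm_of_mem_maximalAtlas hψ hξ.1))

/-- The differential of the immersion in coordinates. -/
theorem chartVec_mfderiv (hφ : φ ∈ charts (n + 1) N) (hψ : ψ ∈ charts n M)
    (hξ : ξ ∈ S.domain φ ψ)
    (v : EuclideanSpace ℝ (Fin n)) :
    chartVec φ (S.x (ψ.symm ξ)) (mfderiv (𝓡 n) (𝓡 (n + 1)) S.x (ψ.symm ξ) (chartVecSymm ψ ξ v)) =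
      fderiv ℝ (S.coord φ ψ) ξ v := by
  have h1 : MDifferentiableAt (𝓡 n) (𝓡 n) ψ.symm ξ :=
    (contMDiffAt_symm_of_mem_maximalAtlas hψ hξ.1).mdifferentiableAt (by norm_num)
  have h2 : MDifferentiableAt (𝓡 n) (𝓡 (n + 1)) S.x (ψ.symm ξ) :=
    S.contMDiff.contMDiffAt.mdifferentiableAt (by norm_num)
  have h3 : MDifferentiableAt (𝓡 (n + 1)) (𝓡 (n + 1)) φ (S.x (ψ.symm ξ)) :=
    (contMDiffAt_of_mem_maximalAtlas hφ hξ.2).mdifferentiableAt (by norm_num)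
  have h4 := (h3.hasMFDerivAt.comp ξ (h2.hasMFDerivAt.comp ξ h1.hasMFDerivAt)).mfderiv
  rw [← mfderiv_eq_fderiv]
  exact (congrArg (fun L => L v) h4).symm

theorem tangentM_mulVec (hφ : φ ∈ charts (n + 1) N) (hψ : ψ ∈ charts n M)
    (hξ : ξ ∈ S.domain φ ψ)
    (v : EuclideanSpace ℝ (Fin n)) :
    tangentM (S.coord φ ψ) ξ *ᵥ v.ofLp = (fderiv ℝ (S.coord φ ψ) ξ v).ofLp := by
  have hd : DifferentiableAt ℝ (S.coord φ ψ) ξ :=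
    (S.contDiffAt_coord hφ hψ hξ).differentiableAt (by norm_num)
  have h2 : v = ∑ a, v a • EuclideanSpace.single a (1 : ℝ) := by
    ext c
    simp [Finset.sum_apply, Pi.single_apply]
  conv_rhs => rw [h2, map_sum]
  ext a
  simp only [map_smul, Matrix.mulVec, dotProduct, tangentM, Matrix.of_apply, pd_coord hd,
    WithLp.ofLp_sum, Finset.sum_apply, WithLp.ofLp_smul, Pi.smul_apply, smul_eq_mul]
  exact Finset.sum_congr rfl fun i _ => mul_comm _ _

theorem form_mfderiv (hφ : φ ∈ charts (n + 1) N) (hψ : ψ ∈ charts n M)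
    (hξ : ξ ∈ S.domain φ ψ)
    (v : TangentSpace (𝓡 (n + 1)) (S.x (ψ.symm ξ)))
    (w : EuclideanSpace ℝ (Fin n)) :
    g.form (S.x (ψ.symm ξ)) v
      (mfderiv (𝓡 n) (𝓡 (n + 1)) S.x (ψ.symm ξ) (chartVecSymm ψ ξ w)) =
    (chartVec φ (S.x (ψ.symm ξ)) v).ofLp ⬝ᵥ components g.form φ (S.coord φ ψ ξ) *ᵥ
      (tangentM (S.coord φ ψ) ξ *ᵥ w.ofLp) := by
  rw [form_eq_components g.form hφ (φ.map_source hξ.2) (φ.left_inv hξ.2),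
    S.chartVec_mfderiv hφ hψ hξ, S.tangentM_mulVec hφ hψ hξ]
  rfl

theorem posDef_indMetric (hφ : φ ∈ charts (n + 1) N) (hψ : ψ ∈ charts n M)
    (hξ : ξ ∈ S.domain φ ψ) :
    (indMetric (components g.form φ) (S.coord φ ψ) ξ).PosDef := by
  refine Matrix.PosDef.of_dotProduct_mulVec_pos ?_ fun v hv => ?_
  · rw [Matrix.IsHermitian, Matrix.conjTranspose_eq_transpose_of_trivial]
    exact indMetric_isSymm (components_isSymm g φ)
  · have h1 : chartVecSymm ψ ξ (WithLp.toLp 2 v) ≠ 0 := by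
      intro h
      have h2 := chartVec_chartVecSymm hψ hξ.1 (WithLp.toLp 2 v)
      rw [h, chartVec, map_zero] at h2
      exact hv (congrArg WithLp.ofLp h2).symm
    have h2 := S.spacelike _ _ h1
    rw [S.form_mfderiv hφ hψ hξ, S.chartVec_mfderiv hφ hψ hξ, ← S.tangentM_mulVec hφ hψ hξ] at h2
    rw [indMetric_eq, star_trivial, ← Matrix.mulVec_mulVec, ← Matrix.mulVec_mulVec,
      Matrix.dotProduct_mulVec, Matrix.vecMul_transpose]
    exact h2

/-- A hypersurface in coordinates. -/
theorem isLocalHypersurface (hφ : φ ∈ charts (n + 1) N) (hψ : ψ ∈ charts n M) :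
    IsLocalHypersurface (components g.form φ) (S.coord φ ψ)
      (fun ξ => (S.normal φ ψ ξ).ofLp) (S.domain φ ψ) where
  isOpen := S.isOpen_domain
  symm := components_isSymm g φ
  contDiffAt_metric ξ hξ := contDiffAt_components g hφ (φ.map_source hξ.2)
  det_ne_zero ξ hξ := det_components_ne_zero g hφ (φ.map_source hξ.2)
  contDiffAt_coord ξ hξ := S.contDiffAt_coord hφ hψ hξ
  posDef ξ hξ := S.posDef_indMetric hφ hψ hξ
  orthogonal ξ hξ i := by
    have h := S.form_mfderiv hφ hψ hξ (S.ν (ψ.symm ξ)) (EuclideanSpace.single i 1)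
    rw [S.ν_orthogonal] at h
    have h2 : tangentM (S.coord φ ψ) ξ *ᵥ (EuclideanSpace.single i (1 : ℝ)).ofLp =
        (tangentM (S.coord φ ψ) ξ).col i := by
      rw [PiLp.ofLp_single, Matrix.mulVec_single_one]
    rw [h2] at h
    exact h.symm
  unit ξ hξ := by
    have h := S.ν_unit (ψ.symm ξ)
    rw [form_eq_components g.form hφ (φ.map_source hξ.2) (φ.left_inv hξ.2)] at h
    exact h
  continuousAt ξ hξ := by
    have h1 : ContinuousOn (fun ξ => (⟨S.x (ψ.symm ξ), S.ν (ψ.symm ξ)⟩ :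
        TangentBundle (𝓡 (n + 1)) N)) (S.domain φ ψ) :=
      S.ν_continuous.comp_continuousOn (ψ.symm.continuousOn.mono fun _ h => h.1)
    have h2 := (continuousOn_chartVec hφ).comp h1 fun _ h => h.2
    exact (PiLp.continuous_ofLp 2 _).continuousAt.comp
      (h2.continuousAt (S.isOpen_domain.mem_nhds hξ))

end SpacelikeHypersurface

end CurvatureFlow

end

/-! ### Conclusion. -/

theorem mainTheorem6 (n : ℕ) {N : Type u} [TopologicalSpace N]
    [ChartedSpace (EuclideanSpace ℝ (Fin (n + 1))) N] [IsManifold (𝓡 (n + 1)) 3 N]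
    (g : CurvatureFlow.SemiRiemannianMetric (n + 1) N) :
    (g.HasConstantCurvature → ∀ k : ℕ, 1 ≤ k → k ≤ n →
      CurvatureFlow.IsClassD.{u, v} g (CurvatureFlow.elemSymm n k)
        (CurvatureFlow.coneOfDefinition n k)) ∧
    (2 ≤ n → g.IsEinstein →
      CurvatureFlow.IsClassD.{u, v} g (CurvatureFlow.elemSymm n 2)
        (CurvatureFlow.coneOfDefinition n 2)) := by
  refine ⟨?_, ?_⟩
  · rintro ⟨K, hK⟩ k hk hkn M _ _ _ S - φ hφ ψ hψ ξ hξ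
    obtain ⟨k, rfl⟩ := Nat.exists_eq_add_of_le' hk
    have L := S.isLocalHypersurface hφ hψ
    -- In coordinates `inducedMetric` and `secondFundamentalForm` unfold to `indMetric` and
    -- `secondForm`, so the local results apply as they stand. The curvature hypothesis is needed
    -- only at the image point.
    exact ⟨fun i j => (CurvatureFlow.curvatureOperator_elemSymm_deriv (L.secondForm_symm hξ)
      (L.posDef ξ hξ) k hkn i j).differentiableAt,
      L.divergenceFree_of_sectionalCurvature hξ (hK φ hφ _ (φ.map_source hξ.2)) k hkn⟩
  · rintro hn ⟨c, hc⟩ M _ _ _ S - φ hφ ψ hψ ξ hξ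
    have L := S.isLocalHypersurface hφ hψ
    exact ⟨fun i j => (CurvatureFlow.curvatureOperator_elemSymm_deriv (L.secondForm_symm hξ)
      (L.posDef ξ hξ) 1 hn i j).differentiableAt,
      L.divergenceFree_of_einstein hξ (hc φ hφ _ (φ.map_source hξ.2)) hn⟩
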